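/- Let $(Q,I)$ be the quiver with vertices $0,1$, arrows $a_1,a_2\colon 0\to 1$, $b_1,b_2\colon 1\to 0$, loops $c$ at $0$ and $d$ at $1$, and relations $a_2b_ia_1=a_1b_ia_2$, $b_2a_ib_1=b_1a_ib_2$, $da_i=a_ic$, $cb_i=b_id$ $(i=1,2)$. A framed representation is a finite-dimensional complex representation $(V_0,V_1)$ of $(Q,I)$ together with $V_\infty=\mathbb{C}$ and a linear map $V_\infty\to V_0$. For $\Theta=(\theta_0,\theta_1)\in\mathbb{R}^2$ put $\Theta(V_0,V_1)=\theta_0\dim V_0+\theta_1\dim V_1$. The framed representation is $\Theta$-stable if $\Theta(V_0',V_1')<0$ for every non-zero subrepresentation $(V_0',V_1',0)$, and $\Theta(V_0',V_1')<\Theta(V_0,V_1)$ for every proper subrepresentation $(V_0',V_1',V_\infty'=\mathbb{C})$. Let $X_0=\mathrm{Tot}_{\mathbb{P}^1}(\mathcal{O}(-1)\oplus\mathcal{O}(-1)\oplus\mathcal{O})$, and let $X_0^+$ be its flop over $\operatorname{Spec}\mathbb{C}[x,y,z,w,u]/(xy-zw)$, which is again a copy of $\mathcal{O}_{\mathbb{P}^1}(-1,-1,0)$.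 Let $\Phi_0=\mathbf{R}\mathrm{Hom}(\mathcal{O}_{X_0}\oplus\mathcal{O}_{X_0}(1),-)$ and $\Phi_0^+=\mathbf{R}\mathrm{Hom}(\mathcal{O}_{X_0^+}\oplus\mathcal{O}_{X_0^+}(-1),-)$, with values in the derived category of representations of $(Q,I)$. Here the arrows act by precomposition: for $\Phi_0$, with the homogeneous coordinates $b_i\colon\mathcal{O}\to\mathcal{O}(1)$, the fibre coordinates $a_i\colon\mathcal{O}(1)\to\mathcal{O}$ and the coordinate $c=d$ of the trivial summand; for $\Phi_0^+$, with the homogeneous coordinates $a_i\colon\mathcal{O}(-1)\to\mathcal{O}$, the fibre coordinates $b_i\colon\mathcal{O}\to\mathcal{O}(-1)$ and the coordinate $c=d$ of the trivial summand. For $a\in\mathbb{C}$, let $j_a$ be the closed immersion of $\mathbb{P}^1$ as the zero section of $\mathcal{O}_{\mathbb{P}^1}(-1,-1)\times\{a\}\subset\mathcal{O}_{\mathbb{P}^1}(-1,-1,0)$. **Proposition.** Let $V=(V_0,V_1,V_\infty=\mathbb{C})$ be a framed representation such that $V_\infty\to V_0$ is an isomorphism and $\dim V_1\neq 1$. Then: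 - if $\theta_0<0$ and $\theta_0+2\theta_1>0$ (chamber I), $V$ is $\Theta$-stable if and only if $(V_0,V_1)\cong\Phi_0(j_{a*}\mathcal{O}_{\mathbb{P}^1})$ for some $a\in\mathbb{C}$; - if $\theta_1>0$ and $\theta_0+2\theta_1<0$ (chamber II), $V$ is $\Theta$-stable if and only if $(V_0,V_1)\cong\Phi_0(j_{a*}\mathcal{O}_{\mathbb{P}^1})$ or $(V_0,V_1)\cong\Phi_0(j_{a*}\mathcal{O}_{\mathbb{P}^1}(-2)[1])$ for some $a\in\mathbb{C}$; - if $\theta_0<0$ and $\theta_1<0$ (chamber III), $V$ is $\Theta$-stable if and only if $(V_0,V_1)\cong\Phi_0(j_{a*}\mathcal{O}_{\mathbb{P}^1})$ or $(V_0,V_1)\cong\Phi_0^+(j_{a*}\mathcal{O}_{\mathbb{P}^1})$ for some $a\in\mathbb{C}$; - if $\theta_0>0$ and $\theta_0+2\theta_1<0$ (chamber IV), $V$ is $\Theta$-stable if and only if $(V_0,V_1)\cong\Phi_0^+(j_{a*}\mathcal{O}_{\mathbb{P}^1})$ for some $a\in\mathbb{C}$; - if $\theta_1<0$ and $\theta_0+2\theta_1>0$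 (chamber V), $V$ is not $\Theta$-stable. -/

import Mathlib

open CategoryTheory
open scoped LaurentPolynomial

noncomputable section

namespace Conifold

/-! ## The quiver with relations `(Q, I)` and its representations -/

/-- The two vertices of `Q`. -/
inductive Vertex
  | v0
  | v1

/-- The arrows of `Q`: `a₁, a₂ : 0 → 1`, `b₁, b₂ : 1 → 0` and loops `c`, `d` at `0`, `1`
(the index set `{1, 2}` is `Fin 2`). -/
inductive Arrow : Vertex → Vertex → Type
  | a (i : Fin 2) : Arrow Vertex.v0 Vertex.v1
  | b (i : Fin 2) : Arrow Vertex.v1 Vertex.v0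
  | c : Arrow Vertex.v0 Vertex.v0
  | d : Arrow Vertex.v1 Vertex.v1

instance : Quiver Vertex where
  Hom := Arrow

/-- The arrow `e`, as a path of length one in the free category on `Q`. -/
def arr {x y : Vertex} (e : Arrow x y) : (Paths.of Vertex).obj x ⟶ (Paths.of Vertex).obj y :=
  (Paths.of Vertex).map e

/-- The relations `I`: `a₂ bᵢ a₁ = a₁ bᵢ a₂`, `b₂ aᵢ b₁ = b₁ aᵢ b₂`, `d aᵢ = aᵢ c`, `c bᵢ = bᵢ d`.
Arrows compose from right to left in these formulas; `≫` composes from left to right. -/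
inductive Rel : HomRel (Paths Vertex)
  | aba (i : Fin 2) : Rel (arr (.a 0) ≫ arr (.b i) ≫ arr (.a 1))
      (arr (.a 1) ≫ arr (.b i) ≫ arr (.a 0))
  | bab (i : Fin 2) : Rel (arr (.b 0) ≫ arr (.a i) ≫ arr (.b 1))
      (arr (.b 1) ≫ arr (.a i) ≫ arr (.b 0))
  | da (i : Fin 2) : Rel (arr (.a i) ≫ arr .d) (arr .c ≫ arr (.a i))
  | cb (i : Fin 2) : Rel (arr (.b i) ≫ arr .c) (arr .d ≫ arr (.b i))

/-- The abelian category of complex representations of `(Q, I)`, i.e. of `ℂQ/I`-modules: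
functors to vector spaces from the path category of `Q` modulo the relations `I`. For a bounded
complex of finitely generated modules and a finitely generated module, isomorphism in the derived
category of `RepCat` is the same as isomorphism in `D^b mod (ℂQ/I)`. -/
abbrev RepCat := CategoryTheory.Quotient Rel ⥤ ModuleCat.{0} ℂ

/-- A representation of `(Q, I)`, given by linear-algebra data. -/
structure QuiverRep where
  V₀ : Type
  V₁ : Type
  [grp₀ : AddCommGroup V₀]
  [grp₁ : AddCommGroup V₁]
  [mod₀ : Module ℂ V₀]
  [mod₁ : Module ℂ V₁]
  a : Fin 2 → V₀ →ₗ[ℂ] V₁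
  b : Fin 2 → V₁ →ₗ[ℂ] V₀
  c : V₀ →ₗ[ℂ] V₀
  d : V₁ →ₗ[ℂ] V₁
  aba : ∀ i v, a 1 (b i (a 0 v)) = a 0 (b i (a 1 v))
  bab : ∀ i v, b 1 (a i (b 0 v)) = b 0 (a i (b 1 v))
  da : ∀ i v, d (a i v) = a i (c v)
  cb : ∀ i v, c (b i v) = b i (d v)

attribute [instance] QuiverRep.grp₀ QuiverRep.grp₁ QuiverRep.mod₀ QuiverRep.mod₁

namespace QuiverRep

/-- The vector space at a vertex. -/
def obj (V : QuiverRep) : Vertex → ModuleCat.{0} ℂ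
  | .v0 => ModuleCat.of ℂ V.V₀
  | .v1 => ModuleCat.of ℂ V.V₁

/-- The linear map of an arrow. -/
def mapArrow (V : QuiverRep) : ∀ {x y : Vertex}, Arrow x y → (V.obj x ⟶ V.obj y)
  | _, _, .a i => ModuleCat.ofHom (V.a i)
  | _, _, .b i => ModuleCat.ofHom (V.b i)
  | _, _, .c => ModuleCat.ofHom V.c
  | _, _, .d => ModuleCat.ofHom V.d

/-- The representation of the free path category. -/
def pathFunctor (V : QuiverRep) : Paths Vertex ⥤ ModuleCat.{0} ℂ :=
  Paths.lift { obj := V.obj, map := fun e => V.mapArrow e }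

theorem pathFunctor_map_arr (V : QuiverRep) {x y : Vertex} (e : Arrow x y) :
    V.pathFunctor.map (arr e) = V.mapArrow e :=
  Paths.lift_toPath _ _

/-- A representation as an object of the abelian category `RepCat`. -/
def toRepCat (V : QuiverRep) : RepCat :=
  CategoryTheory.Quotient.lift Rel V.pathFunctor (by
    intro x y f₁ f₂ h
    cases h with
    | aba i =>
      simp only [Functor.map_comp, pathFunctor_map_arr]
      exact ModuleCat.hom_ext (LinearMap.ext (V.aba i))
    | bab i =>
      simp only [Functor.map_comp, pathFunctor_map_arr]
      exact ModuleCat.hom_ext (LinearMap.ext (V.bab i))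
    | da i =>
      simp only [Functor.map_comp, pathFunctor_map_arr]
      exact ModuleCat.hom_ext (LinearMap.ext (V.da i))
    | cb i =>
      simp only [Functor.map_comp, pathFunctor_map_arr]
      exact ModuleCat.hom_ext (LinearMap.ext (V.cb i)))

/-- A morphism of representations: linear maps at the two vertices commuting with the arrows. -/
structure Hom (V W : QuiverRep) where
  f₀ : V.V₀ →ₗ[ℂ] W.V₀
  f₁ : V.V₁ →ₗ[ℂ] W.V₁
  comm_a : ∀ i v, f₁ (V.a i v) = W.a i (f₀ v)
  comm_b : ∀ i v, f₀ (V.b i v) = W.b i (f₁ v)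
  comm_c : ∀ v, f₀ (V.c v) = W.c (f₀ v)
  comm_d : ∀ v, f₁ (V.d v) = W.d (f₁ v)

/-- The component of a morphism at a vertex. -/
def Hom.app {V W : QuiverRep} (f : Hom V W) : ∀ x : Vertex, V.obj x ⟶ W.obj x
  | .v0 => ModuleCat.ofHom f.f₀
  | .v1 => ModuleCat.ofHom f.f₁

theorem Hom.naturality {V W : QuiverRep} (f : Hom V W) {x y : Vertex} (e : Arrow x y) :
    V.mapArrow e ≫ f.app y = f.app x ≫ W.mapArrow e := by
  cases e with
  | a i => exact ModuleCat.hom_ext (LinearMap.ext (f.comm_a i))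
  | b i => exact ModuleCat.hom_ext (LinearMap.ext (f.comm_b i))
  | c => exact ModuleCat.hom_ext (LinearMap.ext f.comm_c)
  | d => exact ModuleCat.hom_ext (LinearMap.ext f.comm_d)

theorem Hom.naturality_path {V W : QuiverRep} (f : Hom V W) {x y : Paths Vertex} (p : x ⟶ y) :
    V.pathFunctor.map p ≫ f.app y = f.app x ≫ W.pathFunctor.map p := by
  induction p using Paths.induction_fixed_source with
  | id => exact (Category.id_comp _).trans (Category.comp_id _).symm
  | comp p e ih =>
    change (V.pathFunctor.map p ≫ V.mapArrow e) ≫ f.app _ =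
      f.app _ ≫ (W.pathFunctor.map p ≫ W.mapArrow e)
    refine (Category.assoc _ _ _).trans ((congrArg (V.pathFunctor.map p ≫ ·)
      (f.naturality e)).trans ((Category.assoc _ _ _).symm.trans ?_))
    exact (congrArg (· ≫ W.mapArrow e) ih).trans (Category.assoc _ _ _)

/-- A morphism of representations as a morphism of the abelian category `RepCat`. -/
def Hom.toRepCat {V W : QuiverRep} (f : Hom V W) : V.toRepCat ⟶ W.toRepCat where
  app x := f.app x.as
  naturality := by
    rintro ⟨x⟩ ⟨y⟩ ⟨p⟩
    exact f.naturality_path p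

end QuiverRep

/-- The choice of a model of the derived category of the abelian category of representations
(it exists in the stated universe and is unique up to equivalence). -/
instance : HasDerivedCategory.{1} RepCat := HasDerivedCategory.standard RepCat

/-! ## Framed representations and stability -/

/-- A representation `(V₀, V₁, V_∞ = ℂ)` of the framed quiver: the linear map `ι` belongs to the
extra arrow `∞ → 0`. -/
structure FramedRep extends QuiverRep where
  ι : ℂ →ₗ[ℂ] V₀

/-- `(W₀, W₁)` is a subrepresentation of the unframed representation. -/
structure QuiverRep.IsSubrep (V : QuiverRep) (W₀ : Submodule ℂ V.V₀) (W₁ : Submodule ℂ V.V₁) :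
    Prop where
  a : ∀ i, ∀ v ∈ W₀, V.a i v ∈ W₁
  b : ∀ i, ∀ v ∈ W₁, V.b i v ∈ W₀
  c : ∀ v ∈ W₀, V.c v ∈ W₀
  d : ∀ v ∈ W₁, V.d v ∈ W₁

/-- `Θ(W₀, W₁) = θ₀ dim W₀ + θ₁ dim W₁`. -/
def Theta (Θ : ℝ × ℝ) (W₀ W₁ : Type) [AddCommGroup W₀] [Module ℂ W₀] [AddCommGroup W₁]
    [Module ℂ W₁] : ℝ :=
  Θ.1 * Module.finrank ℂ W₀ + Θ.2 * Module.finrank ℂ W₁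

/-- `Θ`-stability of a (finite-dimensional) framed representation with `V_∞ = ℂ`.
The first clause concerns the nonzero subrepresentations `(W₀, W₁, 0)`, the second one the proper
subrepresentations `(W₀, W₁, ℂ)`. -/
structure FramedRep.IsStable (V : FramedRep) (Θ : ℝ × ℝ) : Prop where
  sub_zero : ∀ (W₀ : Submodule ℂ V.V₀) (W₁ : Submodule ℂ V.V₁), V.IsSubrep W₀ W₁ →
    ¬ (W₀ = ⊥ ∧ W₁ = ⊥) → Theta Θ W₀ W₁ < 0
  sub_framed : ∀ (W₀ : Submodule ℂ V.V₀) (W₁ : Submodule ℂ V.V₁), V.IsSubrep W₀ W₁ →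
    (∀ z, V.ι z ∈ W₀) → ¬ (W₀ = ⊤ ∧ W₁ = ⊤) → Theta Θ W₀ W₁ < Theta Θ V.V₀ V.V₁

/-! ## Chambers: the regions cut out by the lines `θ₀ = 0`, `θ₁ = 0`, `θ₀ + 2 θ₁ = 0` -/

def chamberI : Set (ℝ × ℝ) := {Θ | Θ.1 < 0 ∧ 0 < Θ.1 + 2 * Θ.2}
def chamberII : Set (ℝ × ℝ) := {Θ | 0 < Θ.2 ∧ Θ.1 + 2 * Θ.2 < 0}
def chamberIII : Set (ℝ × ℝ) := {Θ | Θ.1 < 0 ∧ Θ.2 < 0}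
def chamberIV : Set (ℝ × ℝ) := {Θ | 0 < Θ.1 ∧ Θ.1 + 2 * Θ.2 < 0}
def chamberV : Set (ℝ × ℝ) := {Θ | Θ.2 < 0 ∧ 0 < Θ.1 + 2 * Θ.2}

/-! ## Schemes with two affine charts, and quasi-coherent sheaves on them -/

/-- A complex scheme `U₀ ∪ U₁` glued from `U₀ = Spec A₀` and `U₁ = Spec A₁` along
`U₀ ∩ U₁ = Spec A₀₁`, where `r₀`, `r₁` identify `Spec A₀₁` with the principal open subsets
`{f₀ ≠ 0} ⊆ U₀` and `{f₁ ≠ 0} ⊆ U₁`. -/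
structure TwoChart where
  A₀ : Type
  A₁ : Type
  A₀₁ : Type
  [ring₀ : CommRing A₀]
  [ring₁ : CommRing A₁]
  [ring₀₁ : CommRing A₀₁]
  [alg₀ : Algebra ℂ A₀]
  [alg₁ : Algebra ℂ A₁]
  [alg₀₁ : Algebra ℂ A₀₁]
  r₀ : A₀ →ₐ[ℂ] A₀₁
  r₁ : A₁ →ₐ[ℂ] A₀₁
  f₀ : A₀
  f₁ : A₁
  loc₀ : @IsLocalization.Away A₀ _ f₀ A₀₁ _ r₀.toRingHom.toAlgebra
  loc₁ : @IsLocalization.Away A₁ _ f₁ A₀₁ _ r₁.toRingHom.toAlgebra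

attribute [instance] TwoChart.ring₀ TwoChart.ring₁ TwoChart.ring₀₁ TwoChart.alg₀ TwoChart.alg₁
  TwoChart.alg₀₁

/-- A quasi-coherent sheaf on `U₀ ∪ U₁`: its modules of sections `M₀`, `M₁`, `M₀₁` over `U₀`, `U₁`,
`U₀ ∩ U₁` and its restriction maps `ρ₀`, `ρ₁`, which exhibit `M₀₁` as the localization of `M₀` at
`f₀` and of `M₁` at `f₁`. -/
structure QCoh (X : TwoChart) where
  M₀ : Type
  M₁ : Type
  M₀₁ : Type
  [grp₀ : AddCommGroup M₀]
  [grp₁ : AddCommGroup M₁]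
  [grp₀₁ : AddCommGroup M₀₁]
  [vs₀ : Module ℂ M₀]
  [vs₁ : Module ℂ M₁]
  [vs₀₁ : Module ℂ M₀₁]
  [mod₀ : Module X.A₀ M₀]
  [mod₁ : Module X.A₁ M₁]
  [mod₀₁ : Module X.A₀₁ M₀₁]
  [tower₀ : IsScalarTower ℂ X.A₀ M₀]
  [tower₁ : IsScalarTower ℂ X.A₁ M₁]
  [tower₀₁ : IsScalarTower ℂ X.A₀₁ M₀₁]
  ρ₀ : M₀ →ₗ[ℂ] M₀₁
  ρ₁ : M₁ →ₗ[ℂ] M₀₁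
  ρ₀_smul : ∀ (g : X.A₀) (m : M₀), ρ₀ (g • m) = X.r₀ g • ρ₀ m
  ρ₁_smul : ∀ (g : X.A₁) (m : M₁), ρ₁ (g • m) = X.r₁ g • ρ₁ m
  surj₀ : ∀ m : M₀₁, ∃ (k : ℕ) (n : M₀), X.r₀ (X.f₀ ^ k) • m = ρ₀ n
  surj₁ : ∀ m : M₀₁, ∃ (k : ℕ) (n : M₁), X.r₁ (X.f₁ ^ k) • m = ρ₁ n
  ker₀ : ∀ m : M₀, ρ₀ m = 0 → ∃ k : ℕ, X.f₀ ^ k • m = 0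
  ker₁ : ∀ m : M₁, ρ₁ m = 0 → ∃ k : ℕ, X.f₁ ^ k • m = 0

attribute [instance] QCoh.grp₀ QCoh.grp₁ QCoh.grp₀₁ QCoh.vs₀ QCoh.vs₁ QCoh.vs₀₁
  QCoh.mod₀ QCoh.mod₁ QCoh.mod₀₁ QCoh.tower₀ QCoh.tower₁ QCoh.tower₀₁

theorem TwoChart.surj₀ (X : TwoChart) (m : X.A₀₁) :
    ∃ (k : ℕ) (n : X.A₀), X.r₀ (X.f₀ ^ k) * m = X.r₀ n := by
  let := X.r₀.toRingHom.toAlgebra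
  have : IsLocalization.Away X.f₀ X.A₀₁ := X.loc₀
  obtain ⟨k, n, h⟩ := IsLocalization.Away.surj X.f₀ m
  refine ⟨k, n, ?_⟩
  rw [map_pow, mul_comm]
  exact h

theorem TwoChart.surj₁ (X : TwoChart) (m : X.A₀₁) :
    ∃ (k : ℕ) (n : X.A₁), X.r₁ (X.f₁ ^ k) * m = X.r₁ n := by
  let := X.r₁.toRingHom.toAlgebra
  have : IsLocalization.Away X.f₁ X.A₀₁ := X.loc₁
  obtain ⟨k, n, h⟩ := IsLocalization.Away.surj X.f₁ m
  refine ⟨k, n, ?_⟩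
  rw [map_pow, mul_comm]
  exact h

theorem TwoChart.ker₀ (X : TwoChart) (m : X.A₀) (hm : X.r₀ m = 0) :
    ∃ k : ℕ, X.f₀ ^ k * m = 0 := by
  let := X.r₀.toRingHom.toAlgebra
  have : IsLocalization.Away X.f₀ X.A₀₁ := X.loc₀
  obtain ⟨k, h⟩ := IsLocalization.Away.exists_of_eq (S := X.A₀₁) X.f₀
    (a := m) (b := 0) (by rw [map_zero]; exact hm)
  exact ⟨k, by simpa using h⟩

theorem TwoChart.ker₁ (X : TwoChart) (m : X.A₁) (hm : X.r₁ m = 0) :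
    ∃ k : ℕ, X.f₁ ^ k * m = 0 := by
  let := X.r₁.toRingHom.toAlgebra
  have : IsLocalization.Away X.f₁ X.A₀₁ := X.loc₁
  obtain ⟨k, h⟩ := IsLocalization.Away.exists_of_eq (S := X.A₀₁) X.f₁
    (a := m) (b := 0) (by rw [map_zero]; exact hm)
  exact ⟨k, by simpa using h⟩

/-- The line bundle with generators `e₀` on `U₀` and `e₁` on `U₁` and `e₁ = u e₀` on `U₀ ∩ U₁`;
sections over `U₀`, `U₀ ∩ U₁` are written in the generator `e₀`, sections over `U₁` in `e₁`. -/
def lineBundle (X : TwoChart) (u : X.A₀₁ˣ) : QCoh X where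
  M₀ := X.A₀
  M₁ := X.A₁
  M₀₁ := X.A₀₁
  ρ₀ := X.r₀.toLinearMap
  ρ₁ := (LinearMap.mulLeft ℂ (u : X.A₀₁)) ∘ₗ X.r₁.toLinearMap
  ρ₀_smul g m := by simp
  ρ₁_smul g m := by simp [mul_left_comm]
  surj₀ m := X.surj₀ m
  surj₁ m := by
    obtain ⟨k, n, h⟩ := X.surj₁ (↑u⁻¹ * m)
    refine ⟨k, n, ?_⟩
    simp only [LinearMap.comp_apply, AlgHom.toLinearMap_apply, LinearMap.mulLeft_apply, ← h,
      smul_eq_mul]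
    rw [mul_left_comm, Units.mul_inv_cancel_left]
  ker₀ m hm := X.ker₀ m hm
  ker₁ m hm := X.ker₁ m (by
    simpa using hm)

/-- A morphism `P → X` such that the preimages of the charts `U₀`, `U₁` of `X` are the charts
of `P`, given by the ring maps on the charts. -/
structure ChartMap (P X : TwoChart) where
  φ₀ : X.A₀ →ₐ[ℂ] P.A₀
  φ₁ : X.A₁ →ₐ[ℂ] P.A₁
  φ₀₁ : X.A₀₁ →ₐ[ℂ] P.A₀₁
  comm₀ : ∀ g, φ₀₁ (X.r₀ g) = P.r₀ (φ₀ g)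
  comm₁ : ∀ g, φ₀₁ (X.r₁ g) = P.r₁ (φ₁ g)
  map_f₀ : φ₀ X.f₀ = P.f₀
  map_f₁ : φ₁ X.f₁ = P.f₁

/-- The push-forward of a quasi-coherent sheaf: restriction of scalars on each chart. -/
def QCoh.pushforward {P X : TwoChart} (j : ChartMap P X) (F : QCoh P) : QCoh X :=
  letI : Module X.A₀ F.M₀ := Module.compHom F.M₀ j.φ₀.toRingHom
  letI : Module X.A₁ F.M₁ := Module.compHom F.M₁ j.φ₁.toRingHom
  letI : Module X.A₀₁ F.M₀₁ := Module.compHom F.M₀₁ j.φ₀₁.toRingHom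
  { M₀ := F.M₀
    M₁ := F.M₁
    M₀₁ := F.M₀₁
    tower₀ := ⟨fun z g m => by
      change j.φ₀ (z • g) • m = z • (j.φ₀ g • m)
      rw [map_smul, smul_assoc]⟩
    tower₁ := ⟨fun z g m => by
      change j.φ₁ (z • g) • m = z • (j.φ₁ g • m)
      rw [map_smul, smul_assoc]⟩
    tower₀₁ := ⟨fun z g m => by
      change j.φ₀₁ (z • g) • m = z • (j.φ₀₁ g • m)
      rw [map_smul, smul_assoc]⟩
    ρ₀ := F.ρ₀
    ρ₁ := F.ρ₁
    ρ₀_smul := fun g m => by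
      change F.ρ₀ (j.φ₀ g • m) = j.φ₀₁ (X.r₀ g) • F.ρ₀ m
      rw [F.ρ₀_smul, j.comm₀]
    ρ₁_smul := fun g m => by
      change F.ρ₁ (j.φ₁ g • m) = j.φ₀₁ (X.r₁ g) • F.ρ₁ m
      rw [F.ρ₁_smul, j.comm₁]
    surj₀ := fun m => by
      obtain ⟨k, n, h⟩ := F.surj₀ m
      refine ⟨k, n, ?_⟩
      change j.φ₀₁ (X.r₀ (X.f₀ ^ k)) • m = _
      rw [j.comm₀, map_pow, j.map_f₀, h]
    surj₁ := fun m => by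
      obtain ⟨k, n, h⟩ := F.surj₁ m
      refine ⟨k, n, ?_⟩
      change j.φ₀₁ (X.r₁ (X.f₁ ^ k)) • m = _
      rw [j.comm₁, map_pow, j.map_f₁, h]
    ker₀ := fun m hm => by
      obtain ⟨k, h⟩ := F.ker₀ m hm
      refine ⟨k, ?_⟩
      change j.φ₀ (X.f₀ ^ k) • m = 0
      rw [map_pow, j.map_f₀, h]
    ker₁ := fun m hm => by
      obtain ⟨k, h⟩ := F.ker₁ m hm
      refine ⟨k, ?_⟩
      change j.φ₁ (X.f₁ ^ k) • m = 0
      rw [map_pow, j.map_f₁, h] }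

/-! ## `RHom(𝒪 ⊕ L, F)` as a complex of representations of `(Q, I)` -/

/-- A global section of the line bundle `lineBundle X u`: `g₀ e₀` on `U₀` and `g₁ e₁` on `U₁`. -/
structure GlobalSection (X : TwoChart) (u : X.A₀₁ˣ) where
  g₀ : X.A₀
  g₁ : X.A₁
  compat : X.r₀ g₀ = ↑u * X.r₁ g₁

/-- A bundle `𝒪 ⊕ L`, where `L = lineBundle X u`, with endomorphisms for the arrows of `Q`:
`b₁, b₂ : 𝒪 → L`, i.e. sections of `L`, `a₁, a₂ : L → 𝒪`, i.e. sections of the dual of `L`, and a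
function `t`, which gives `c` on `𝒪` and `d` on `L`. -/
structure Tilting (X : TwoChart) where
  u : X.A₀₁ˣ
  b : Fin 2 → GlobalSection X u
  a : Fin 2 → GlobalSection X u⁻¹
  t : GlobalSection X 1

namespace Tilting

variable {X : TwoChart} (P : Tilting X) (F : QCoh X)

/-- Multiplication by `g₀` on `M₀` and by `g₁` on `M₁`. -/
def mulPair {u : X.A₀₁ˣ} (s : GlobalSection X u) : (F.M₀ × F.M₁) →ₗ[ℂ] (F.M₀ × F.M₁) :=
  LinearMap.prodMap (Algebra.lsmul ℂ ℂ F.M₀ s.g₀) (Algebra.lsmul ℂ ℂ F.M₁ s.g₁)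

/-- Multiplication by `g₀` on `M₀₁`. -/
def mulOverlap {u : X.A₀₁ˣ} (s : GlobalSection X u) : F.M₀₁ →ₗ[ℂ] F.M₀₁ :=
  Algebra.lsmul ℂ ℂ F.M₀₁ (X.r₀ s.g₀)

theorem mulPair_comm {u v : X.A₀₁ˣ} (s : GlobalSection X u) (s' : GlobalSection X v)
    (m : F.M₀ × F.M₁) : mulPair F s (mulPair F s' m) = mulPair F s' (mulPair F s m) :=
  Prod.ext (smul_comm s.g₀ s'.g₀ m.1) (smul_comm s.g₁ s'.g₁ m.2)

theorem mulOverlap_comm {u v : X.A₀₁ˣ} (s : GlobalSection X u) (s' : GlobalSection X v)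
    (m : F.M₀₁) : mulOverlap F s (mulOverlap F s' m) = mulOverlap F s' (mulOverlap F s m) :=
  smul_comm (X.r₀ s.g₀) (X.r₀ s'.g₀) m

/-- The Čech complex of the sheaf `ℋom(lineBundle X u, F)` for the cover `{U₀, U₁}`: a pair of
homomorphisms over `U₀`, `U₁`, given by `m₀ = φ(e₀)` and `m₁ = φ(e₁)`, goes to the difference over
`U₀ ∩ U₁`, where homomorphisms are written as `φ(e₀)`. As the cover is affine with affine
intersection, this complex represents `RHom(lineBundle X u, F)`. -/
def cechD (u : X.A₀₁ˣ) : (F.M₀ × F.M₁) →ₗ[ℂ] F.M₀₁ :=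
  (Algebra.lsmul ℂ ℂ F.M₀₁ (↑u⁻¹ : X.A₀₁)) ∘ₗ F.ρ₁ ∘ₗ LinearMap.snd ℂ F.M₀ F.M₁ -
    F.ρ₀ ∘ₗ LinearMap.fst ℂ F.M₀ F.M₁

theorem cechD_mulPair {u v w : X.A₀₁ˣ} (s : GlobalSection X w) (h : v = u * w)
    (m : F.M₀ × F.M₁) : cechD F u (mulPair F s m) = mulOverlap F s (cechD F v m) := by
  have e : (↑u⁻¹ : X.A₀₁) = ↑w * ↑v⁻¹ := by
    rw [← Units.val_mul, h]; simp
  simp only [cechD, mulPair, mulOverlap, LinearMap.sub_apply, LinearMap.comp_apply,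
    LinearMap.snd_apply, LinearMap.fst_apply, LinearMap.prodMap_apply, Algebra.lsmul_coe,
    F.ρ₁_smul, F.ρ₀_smul, smul_sub, smul_smul]
  rw [s.compat]
  congr 2
  rw [e]
  ring

/-- Degree `0` of the Čech complex of `RHom(𝒪 ⊕ L, F)`: the vector space of `RHom(𝒪, F)` at the
vertex `0`, that of `RHom(L, F)` at the vertex `1`, and each arrow acts by precomposition. -/
def cech₀ : QuiverRep where
  V₀ := F.M₀ × F.M₁
  V₁ := F.M₀ × F.M₁
  a i := mulPair F (P.a i)
  b i := mulPair F (P.b i)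
  c := mulPair F P.t
  d := mulPair F P.t
  aba i v := by
    rw [mulPair_comm F (P.b i) (P.a 0), mulPair_comm F (P.a 1) (P.a 0),
      mulPair_comm F (P.a 1) (P.b i)]
  bab i v := by
    rw [mulPair_comm F (P.a i) (P.b 0), mulPair_comm F (P.b 1) (P.b 0),
      mulPair_comm F (P.b 1) (P.a i)]
  da i v := mulPair_comm F _ _ v
  cb i v := mulPair_comm F _ _ v

/-- Degree `1` of the Čech complex of `RHom(𝒪 ⊕ L, F)`. -/
def cech₁ : QuiverRep where
  V₀ := F.M₀₁
  V₁ := F.M₀₁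
  a i := mulOverlap F (P.a i)
  b i := mulOverlap F (P.b i)
  c := mulOverlap F P.t
  d := mulOverlap F P.t
  aba i v := by
    rw [mulOverlap_comm F (P.b i) (P.a 0), mulOverlap_comm F (P.a 1) (P.a 0),
      mulOverlap_comm F (P.a 1) (P.b i)]
  bab i v := by
    rw [mulOverlap_comm F (P.a i) (P.b 0), mulOverlap_comm F (P.b 1) (P.b 0),
      mulOverlap_comm F (P.b 1) (P.a i)]
  da i v := mulOverlap_comm F _ _ v
  cb i v := mulOverlap_comm F _ _ v

/-- The differential of the Čech complex of `RHom(𝒪 ⊕ L, F)`. -/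
def cechHom : QuiverRep.Hom (P.cech₀ F) (P.cech₁ F) where
  f₀ := cechD F 1
  f₁ := cechD F P.u
  comm_a i v := cechD_mulPair F (P.a i) (by simp) v
  comm_b i v := cechD_mulPair F (P.b i) (by simp) v
  comm_c v := cechD_mulPair F P.t (by simp) v
  comm_d v := cechD_mulPair F P.t (by simp) v

/-- The Čech complex of `RHom(𝒪 ⊕ L, F)`, a cochain complex of representations of `(Q, I)`
lying in degrees `0` and `1`. -/
def cechComplex : CochainComplex RepCat ℤ :=
  HomologicalComplex.double (P.cechHom F).toRepCat
    (show (ComplexShape.up ℤ).Rel 0 1 from zero_add 1)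

/-- `RHom(𝒪 ⊕ L, F)` as an object of the derived category of representations of `(Q, I)`. -/
def rHom : DerivedCategory RepCat :=
  DerivedCategory.Q.obj (P.cechComplex F)

end Tilting

/-! ## The projective line, `X₀ = 𝒪(-1, -1, 0)` and its flop -/

section Geometry

open Polynomial

theorem isLocalization_comp_equiv {A B B' : Type} [CommRing A] [CommRing B] [CommRing B']
    [Algebra ℂ A] [Algebra ℂ B] [Algebra ℂ B'] (f : A) (r : A →ₐ[ℂ] B) (e : B ≃ₐ[ℂ] B')
    (h : @IsLocalization.Away A _ f B _ r.toRingHom.toAlgebra) :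
    @IsLocalization.Away A _ f B' _ (e.toAlgHom.comp r).toRingHom.toAlgebra := by
  let i₁ : Algebra A B := r.toRingHom.toAlgebra
  let i₂ : Algebra A B' := (e.toAlgHom.comp r).toRingHom.toAlgebra
  have : IsLocalization (Submonoid.powers f) B := h
  exact IsLocalization.isLocalization_of_algEquiv (Submonoid.powers f)
    (AlgEquiv.ofRingEquiv (f := e.toRingEquiv) (fun _ => rfl))

/-- The projective line: `U₀ = Spec ℂ[z]`, `U₁ = Spec ℂ[w]`, `U₀ ∩ U₁ = Spec ℂ[z, z⁻¹]`,
`w = z⁻¹`. -/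
def P1 : TwoChart where
  A₀ := ℂ[X]
  A₁ := ℂ[X]
  A₀₁ := ℂ[T;T⁻¹]
  r₀ := Polynomial.toLaurentAlg
  r₁ := (LaurentPolynomial.invert (R := ℂ)).toAlgHom.comp Polynomial.toLaurentAlg
  f₀ := X
  f₁ := X
  loc₀ := LaurentPolynomial.isLocalization
  loc₁ := isLocalization_comp_equiv (A := ℂ[X]) (B := ℂ[T;T⁻¹]) X Polynomial.toLaurentAlg
    LaurentPolynomial.invert LaurentPolynomial.isLocalization

/-- The unit `zⁿ` of `ℂ[z, z⁻¹]`. -/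
def zPow (n : ℤ) : ℂ[T;T⁻¹]ˣ where
  val := LaurentPolynomial.T n
  inv := LaurentPolynomial.T (-n)
  val_inv := by rw [← LaurentPolynomial.T_add]; simp
  inv_val := by rw [← LaurentPolynomial.T_add]; simp

/-- The line bundle `𝒪(n)` on the projective line: `f(z) e₀ = g(w) e₁` means `f(z) = zⁿ g(z⁻¹)`. -/
def P1.O (n : ℤ) : QCoh P1 := lineBundle P1 (zPow n)

/-- The chart `ℂ[z][x₁, x₂, t]` of `𝒪(-1, -1, 0)`. -/
abbrev XChart := MvPolynomial (Fin 3) ℂ[X]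

/-- The overlap `ℂ[z, z⁻¹][x₁, x₂, t]` of the charts of `𝒪(-1, -1, 0)`. -/
abbrev XOverlap := MvPolynomial (Fin 3) ℂ[T;T⁻¹]

/-- The inclusion of `ℂ[z, z⁻¹]` into `ℂ[z, z⁻¹][x₁, x₂, t]`. -/
def XC : ℂ[T;T⁻¹] →ₐ[ℂ] XOverlap := IsScalarTower.toAlgHom ℂ ℂ[T;T⁻¹] XOverlap

/-- The involution `z ↦ z⁻¹`, `xᵢ ↦ z xᵢ`, `t ↦ t` of `ℂ[z, z⁻¹][x₁, x₂, t]`. -/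
def XSwapHom : XOverlap →ₐ[ℂ] XOverlap :=
  MvPolynomial.aevalTower (XC.comp (LaurentPolynomial.invert (R := ℂ)).toAlgHom)
    ![XC (LaurentPolynomial.T 1) * MvPolynomial.X 0,
      XC (LaurentPolynomial.T 1) * MvPolynomial.X 1, MvPolynomial.X 2]

theorem XC_mul_T (m n : ℤ) : XC (LaurentPolynomial.T m) * XC (LaurentPolynomial.T n) =
    XC (LaurentPolynomial.T (m + n)) := by
  rw [← map_mul, ← LaurentPolynomial.T_add]

theorem XC_T_zero : XC (LaurentPolynomial.T 0) = 1 := by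
  rw [LaurentPolynomial.T_zero, map_one]

theorem XSwapHom_XC (f : ℂ[T;T⁻¹]) : XSwapHom (XC f) = XC (LaurentPolynomial.invert f) :=
  MvPolynomial.aevalTower_C _ _ _

theorem XSwapHom_X (i : Fin 3) : XSwapHom (MvPolynomial.X i) =
    ![XC (LaurentPolynomial.T 1) * MvPolynomial.X 0,
      XC (LaurentPolynomial.T 1) * MvPolynomial.X 1, MvPolynomial.X 2] i :=
  MvPolynomial.aevalTower_X _ _ _

theorem XSwapHom_comp : XSwapHom.comp XSwapHom = AlgHom.id ℂ XOverlap := by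
  apply MvPolynomial.algHom_ext'
  · ext
    simp [XSwapHom, XC]
  · intro i
    fin_cases i <;>
      simp [XSwapHom_X, XSwapHom_XC, ← mul_assoc, XC_mul_T]

def XSwap : XOverlap ≃ₐ[ℂ] XOverlap :=
  AlgEquiv.ofAlgHom XSwapHom XSwapHom XSwapHom_comp XSwapHom_comp

theorem X0_isLocalization : @IsLocalization.Away XChart _ (MvPolynomial.C X) XOverlap _
    (MvPolynomial.mapAlgHom (R := ℂ) Polynomial.toLaurentAlg).toRingHom.toAlgebra := by
  have h := MvPolynomial.isLocalization (σ := Fin 3) (Submonoid.powers (X : ℂ[X])) ℂ[T;T⁻¹]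
  rw [Submonoid.map_powers] at h
  exact h

/-- The total space `𝒪(-1, -1, 0)` of `𝒪(-1) ⊕ 𝒪(-1) ⊕ 𝒪` on the projective line:
`U₀ = Spec ℂ[z][x₁, x₂, t]`, `U₁ = Spec ℂ[w][y₁, y₂, t]` with `w = z⁻¹`, `yᵢ = z xᵢ` on the
overlap. -/
def X0 : TwoChart where
  A₀ := XChart
  A₁ := XChart
  A₀₁ := XOverlap
  r₀ := MvPolynomial.mapAlgHom Polynomial.toLaurentAlg
  r₁ := XSwap.toAlgHom.comp (MvPolynomial.mapAlgHom Polynomial.toLaurentAlg)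
  f₀ := MvPolynomial.C X
  f₁ := MvPolynomial.C X
  loc₀ := X0_isLocalization
  loc₁ := isLocalization_comp_equiv (A := XChart) (B := XOverlap) (MvPolynomial.C X)
    (MvPolynomial.mapAlgHom Polynomial.toLaurentAlg) XSwap X0_isLocalization

/-- The ring map `xᵢ ↦ 0`, `t ↦ a`. -/
def evalZero (B : Type) [CommRing B] [Algebra ℂ B] (a : ℂ) : MvPolynomial (Fin 3) B →ₐ[ℂ] B :=
  MvPolynomial.aevalTower (AlgHom.id ℂ B) ![0, 0, algebraMap ℂ B a]

theorem evalZero_C (B : Type) [CommRing B] [Algebra ℂ B] (a : ℂ) (f : B) :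
    evalZero B a (MvPolynomial.C f) = f :=
  MvPolynomial.aevalTower_C _ _ _

theorem j_comm₀ (a : ℂ) : (evalZero ℂ[T;T⁻¹] a).comp X0.r₀ = P1.r₀.comp (evalZero ℂ[X] a) := by
  change (evalZero ℂ[T;T⁻¹] a).comp (MvPolynomial.mapAlgHom Polynomial.toLaurentAlg) =
    Polynomial.toLaurentAlg.comp (evalZero ℂ[X] a)
  apply MvPolynomial.algHom_ext'
  · ext
    simp [evalZero]
  · intro i
    fin_cases i <;> simp [evalZero]

theorem j_comm₁ (a : ℂ) : (evalZero ℂ[T;T⁻¹] a).comp X0.r₁ = P1.r₁.comp (evalZero ℂ[X] a) := by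
  change (evalZero ℂ[T;T⁻¹] a).comp (XSwapHom.comp
      (MvPolynomial.mapAlgHom Polynomial.toLaurentAlg)) =
    ((LaurentPolynomial.invert (R := ℂ)).toAlgHom.comp Polynomial.toLaurentAlg).comp
      (evalZero ℂ[X] a)
  apply MvPolynomial.algHom_ext'
  · ext
    simp [evalZero, XSwapHom, XC]
  · intro i
    fin_cases i <;> simp [evalZero, XSwapHom, XC]

/-- The closed immersion `j_a` of the projective line as the zero section of `𝒪(-1, -1)`,
at the point `t = a` of the line. -/
def j (a : ℂ) : ChartMap P1 X0 where
  φ₀ := evalZero ℂ[X] a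
  φ₁ := evalZero ℂ[X] a
  φ₀₁ := evalZero ℂ[T;T⁻¹] a
  comm₀ g := DFunLike.congr_fun (j_comm₀ a) g
  comm₁ g := DFunLike.congr_fun (j_comm₁ a) g
  map_f₀ := evalZero_C ℂ[X] a X
  map_f₁ := evalZero_C ℂ[X] a X

/-- The transition function `zⁿ` of the line bundle `𝒪(n)` on `𝒪(-1, -1, 0)`. -/
def X0.zPow (n : ℤ) : X0.A₀₁ˣ := Units.map XC.toMonoidHom (Conifold.zPow n)

theorem X0.r₀_apply (g : XChart) :
    X0.r₀ g = MvPolynomial.map Polynomial.toLaurent g := rfl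

theorem X0.r₁_apply (g : XChart) :
    X0.r₁ g = XSwapHom (MvPolynomial.map Polynomial.toLaurent g) := rfl

theorem X0.r₀_C (f : ℂ[X]) : X0.r₀ (MvPolynomial.C f : XChart) = XC (Polynomial.toLaurent f) := by
  rw [X0.r₀_apply, MvPolynomial.map_C]
  rfl

theorem X0.r₁_C (f : ℂ[X]) : X0.r₁ (MvPolynomial.C f : XChart) =
    XC (LaurentPolynomial.invert (Polynomial.toLaurent f)) := by
  rw [X0.r₁_apply, MvPolynomial.map_C]
  exact XSwapHom_XC _

theorem X0.r₀_X (i : Fin 3) : X0.r₀ (MvPolynomial.X i : XChart) = MvPolynomial.X i := by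
  rw [X0.r₀_apply, MvPolynomial.map_X]

theorem X0.r₁_X (i : Fin 3) : X0.r₁ (MvPolynomial.X i : XChart) =
    ![XC (LaurentPolynomial.T 1) * MvPolynomial.X 0,
      XC (LaurentPolynomial.T 1) * MvPolynomial.X 1, MvPolynomial.X 2] i := by
  rw [X0.r₁_apply, MvPolynomial.map_X, XSwapHom_X]

/-- The homogeneous coordinates: the sections `1 = z w` and `z` of `𝒪(1)`. -/
def homogCoord : Fin 2 → GlobalSection X0 (X0.zPow 1)
  | 0 => ⟨(MvPolynomial.C 1 : XChart), (MvPolynomial.C X : XChart), by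
      refine (X0.r₀_C 1).trans (Eq.trans ?_
        (congrArg (XC (LaurentPolynomial.T 1) * ·) (X0.r₁_C X)).symm)
      simp only [Polynomial.toLaurent_X, LaurentPolynomial.invert_T, XC_mul_T, map_one]
      exact XC_T_zero.symm⟩
  | 1 => ⟨(MvPolynomial.C X : XChart), (MvPolynomial.C 1 : XChart), by
      refine (X0.r₀_C X).trans (Eq.trans ?_
        (congrArg (XC (LaurentPolynomial.T 1) * ·) (X0.r₁_C 1)).symm)
      simp only [Polynomial.toLaurent_X, map_one, mul_one]
      rfl⟩

theorem fibreCoord_compat (i : Fin 2) : X0.r₀ (MvPolynomial.X i.castSucc : XChart) =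
    ↑(X0.zPow (-1)) * X0.r₁ (MvPolynomial.X i.castSucc : XChart) := by
  refine (X0.r₀_X _).trans (Eq.trans ?_
    (congrArg (XC (LaurentPolynomial.T (-1)) * ·) (X0.r₁_X _)).symm)
  fin_cases i <;> simp [← mul_assoc, XC_mul_T] <;> rfl

/-- The linear coordinates `xᵢ = z⁻¹ yᵢ` on the fibres of `𝒪(-1, -1)`: tautological sections of
`𝒪(-1)`. -/
def fibreCoord (i : Fin 2) : GlobalSection X0 (X0.zPow (-1)) where
  g₀ := (MvPolynomial.X i.castSucc : XChart)
  g₁ := (MvPolynomial.X i.castSucc : XChart)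
  compat := fibreCoord_compat i

/-- The coordinate `t` on the trivial summand. -/
def tCoord : GlobalSection X0 1 where
  g₀ := (MvPolynomial.X 2 : XChart)
  g₁ := (MvPolynomial.X 2 : XChart)
  compat := (X0.r₀_X 2).trans ((X0.r₁_X 2).symm.trans (one_mul _).symm)

/-- `𝒫₀ = 𝒪 ⊕ 𝒪(1)` on `X₀ = 𝒪(-1, -1, 0)`, with `bᵢ : 𝒪 → 𝒪(1)` the homogeneous coordinates and
`aᵢ : 𝒪(1) → 𝒪` the fibre coordinates. -/
def tilting : Tilting X0 where
  u := X0.zPow 1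
  b := homogCoord
  a := fibreCoord
  t := tCoord

/-- The flop `X₀⁺` of `X₀`, again a copy of `𝒪(-1, -1, 0)`. With the chart coordinates
`(z, x₁, x₂, t)` of `X₀` and `(z⁺, x₁⁺, x₂⁺, t⁺)` of `X₀⁺`, the birational map is
`z⁺ = x₂ / x₁`, `x₁⁺ = x₁`, `x₂⁺ = z x₁`, `t⁺ = t`: the functions `(homogeneous coordinate) ·
(fibre coordinate)`, which define the contractions to `Y₀ = {xy = zw} × ℂ`, agree after exchanging
homogeneous and fibre coordinates. -/
abbrev X0Plus : TwoChart := X0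

/-- `𝒫₀⁺ = 𝒪 ⊕ 𝒪(-1)` on the flop `X₀⁺`. The strict transform identifies the line bundle `𝒪(1)` on
`X₀` with `𝒪(-1)` on `X₀⁺`, the fibre coordinates on `X₀` with the homogeneous coordinates on `X₀⁺`
(`aᵢ : 𝒪(-1) → 𝒪`), and the homogeneous coordinates on `X₀` with the fibre coordinates on `X₀⁺`
(`bᵢ : 𝒪 → 𝒪(-1)`). -/
def tiltingPlus : Tilting X0Plus where
  u := X0.zPow (-1)
  b := fibreCoord
  a := homogCoord
  t := tCoord

/-- `Φ₀(F) = RHom(𝒫₀, F)`. -/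
def Phi (F : QCoh X0) : DerivedCategory RepCat := tilting.rHom F

/-- `Φ₀⁺(F) = RHom(𝒫₀⁺, F)`. -/
def PhiPlus (F : QCoh X0Plus) : DerivedCategory RepCat := tiltingPlus.rHom F

/-- `j_{a*} 𝒪_{ℙ¹}(n)` on `𝒪(-1, -1, 0)`, i.e. on `X₀` or on `X₀⁺`. -/
def jO (a : ℂ) (n : ℤ) : QCoh X0 := (P1.O n).pushforward (j a)

end Geometry

/-- The representation `V`, placed in degree `0`, is isomorphic to `E` in the derived category. -/
def QuiverRep.IsIsoTo (V : QuiverRep) (E : DerivedCategory RepCat) : Prop :=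
  Nonempty ((DerivedCategory.singleFunctor RepCat 0).obj V.toRepCat ≅ E)

end Conifold

end

/-! As `V₀` is a line spanned by the framing vector, a subrepresentation has `W₀ = 0` or `W₀ = V₀`,
and stability collapses to two conditions. One is `θ₀ + θ₁ dim V₁ < 0`, from testing the whole of
`(V₀, V₁, 0)`. The other depends only on the sign of `θ₁`: if `θ₁ > 0`, no nonzero vector of `V₁` is
killed by both `bᵢ` (`isStable_iff_cogenerated`); if `θ₁ < 0`, the images of the `aᵢ` span `V₁`
(`isStable_iff_generated`).

Either condition bounds `dim V₁` by 2, so `dim V₁` is 0 or 2. In dimension 2 the relations leave one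
family each: `a₂ bᵢ a₁ = a₁ bᵢ a₂` forces `b = 0` in the generated case
(`b_a_eq_zero_of_injective`), and `b₂ aᵢ b₁ = b₁ aᵢ b₂` forces `a = 0` in the cogenerated case
(`a_eq_zero_of_surjective`). The loops act by a common scalar `a`. Hence `V` is `vertexRep a`,
`inclRep a` or `projRep a`, and the signs of `θ₀` and `θ₀ + 2θ₁` decide which of them occur.

On the geometric side these are Čech cohomology groups of line bundles on the projective line:
`H⁰(𝒪)` with `H*(𝒪(-1)) = 0` gives `vertexRep`, `H⁰(𝒪) → H⁰(𝒪(1))` gives `inclRep`, and `H¹(𝒪(-3)) →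
H¹(𝒪(-2))` gives `projRep`. The fibre coordinates vanish on the zero section, and `t` acts by `a`.
Since representations embed fully faithfully in the derived category, isomorphism there becomes
linear algebra (`isIsoTo_iff_nonempty_equiv`). -/

noncomputable section

namespace Conifold

/-! ## Two-term complexes in the derived category -/

section Homological

open Limits

universe w v u

/-- Exactness in a functor category is checked objectwise. -/
theorem exact_of_evaluation {T V : Type*} [Category* T] [Category* V] [Abelian V]
    (S : ShortComplex (T ⥤ V)) (h : ∀ t, (S.map ((evaluation T V).obj t)).Exact) : S.Exact := by
  rw [ShortComplex.exact_iff_isZero_homology, Functor.isZero_iff]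
  intro t
  exact ((ShortComplex.exact_iff_isZero_homology _).1 (h t)).of_iso
    (S.mapHomologyIso ((evaluation T V).obj t)).symm

variable {C : Type u} [Category.{v} C] [Abelian C]

theorem exactAt_double {A B : C} (f : A ⟶ B) (n : ℤ) (h₀ : n ≠ 0) (h₁ : n ≠ 1) :
    (HomologicalComplex.double f
      (show (ComplexShape.up ℤ).Rel 0 1 from zero_add 1)).ExactAt n := by
  rw [HomologicalComplex.exactAt_iff]
  exact ShortComplex.exact_of_isZero_X₂ _ (HomologicalComplex.isZero_double_X f
    (show (ComplexShape.up ℤ).Rel 0 1 from zero_add 1) n h₀ h₁)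

/-- The inclusion of a kernel is a quasi-isomorphism to the complex of an epimorphism. -/
theorem quasiIso_to_double {K A B : C} (i : K ⟶ A) (f : A ⟶ B) (w : i ≫ f = 0) [Mono i] [Epi f]
    (hex : (ShortComplex.mk i f w).Exact) :
    ∃ φ : (HomologicalComplex.single C (ComplexShape.up ℤ) 0).obj K ⟶
      HomologicalComplex.double f (show (ComplexShape.up ℤ).Rel 0 1 from zero_add 1),
      QuasiIso φ := by
  have h01 : (0 : ℤ) ≠ 1 := by norm_num
  let D := HomologicalComplex.double f (show (ComplexShape.up ℤ).Rel 0 1 from zero_add 1)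
  let e₀ := HomologicalComplex.doubleXIso₀ f (show (ComplexShape.up ℤ).Rel 0 1 from zero_add 1)
  let e₁ := HomologicalComplex.doubleXIso₁ f (show (ComplexShape.up ℤ).Rel 0 1 from zero_add 1) h01
  have hd : D.d 0 1 = e₀.hom ≫ f ≫ e₁.inv := HomologicalComplex.double_d _ _ h01
  let φ : (HomologicalComplex.single C (ComplexShape.up ℤ) 0).obj K ⟶ D :=
    HomologicalComplex.mkHomFromSingle (i ≫ e₀.inv) (by
      intro k hk
      obtain rfl : 1 = k := by simpa using hk
      rw [hd]
      simp [reassoc_of% w])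
  refine ⟨φ, ⟨fun n => ?_⟩⟩
  by_cases hn : n = 0
  · subst hn
    -- The source has no differentials and nothing enters degree 0 of the target, so the condition
    -- here is that `K → A → B` is exact with `K → A` mono.
    rw [quasiIsoAt_iff' φ (-1) 0 1 (by simp) (by simp),
      ShortComplex.quasiIso_iff_of_zeros]
    · have hφ : φ.f 0 = (HomologicalComplex.singleObjXSelf (ComplexShape.up ℤ) 0 K).hom ≫
        i ≫ e₀.inv := HomologicalComplex.mkHomFromSingle_f _ _
      constructor
      · refine ShortComplex.exact_of_iso ?_ hex
        refine ShortComplex.isoMk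
          (HomologicalComplex.singleObjXSelf (ComplexShape.up ℤ) 0 K).symm e₀.symm e₁.symm ?_ ?_
        · change _ ≫ φ.f 0 = _
          rw [hφ]
          simp
          rfl
        · change _ ≫ D.d 0 1 = _
          rw [hd]
          simp
          rfl
      · change Mono (φ.f 0)
        rw [hφ]
        infer_instance
    · exact HomologicalComplex.single_obj_d (ComplexShape.up ℤ) 0 K _ _
    · exact HomologicalComplex.single_obj_d (ComplexShape.up ℤ) 0 K _ _
    · exact HomologicalComplex.double_d_eq_zero₀ f
            (show (ComplexShape.up ℤ).Rel 0 1 from zero_add 1) _ _ (by norm_num)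
  · rw [quasiIsoAt_iff_exactAt]
    -- In degree 1 the source vanishes, and exactness of the target there says that `f` is epi.
    · by_cases hn1 : n = 1
      · subst hn1
        rw [HomologicalComplex.exactAt_iff' _ 0 1 2 (by simp) (by simp),
          ShortComplex.exact_iff_epi]
        · change Epi (D.d 0 1)
          rw [hd]
          infer_instance
        · exact HomologicalComplex.double_d_eq_zero₀ f
            (show (ComplexShape.up ℤ).Rel 0 1 from zero_add 1) _ _ (by norm_num)
      · exact exactAt_double f n hn hn1
    · rw [HomologicalComplex.exactAt_iff]
      exact ShortComplex.exact_of_isZero_X₂ _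
        (HomologicalComplex.isZero_single_obj_X (ComplexShape.up ℤ) 0 K n hn)

/-- The projection to a cokernel is a quasi-isomorphism from the complex of a monomorphism. -/
theorem quasiIso_from_double {K A B : C} (f : A ⟶ B) (p : B ⟶ K) (w : f ≫ p = 0) [Mono f] [Epi p]
    (hex : (ShortComplex.mk f p w).Exact) :
    ∃ φ : HomologicalComplex.double f (show (ComplexShape.up ℤ).Rel 0 1 from zero_add 1) ⟶
      (HomologicalComplex.single C (ComplexShape.up ℤ) 1).obj K,
      QuasiIso φ := by
  have h01 : (0 : ℤ) ≠ 1 := by norm_num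
  let D := HomologicalComplex.double f (show (ComplexShape.up ℤ).Rel 0 1 from zero_add 1)
  let e₀ := HomologicalComplex.doubleXIso₀ f (show (ComplexShape.up ℤ).Rel 0 1 from zero_add 1)
  let e₁ := HomologicalComplex.doubleXIso₁ f (show (ComplexShape.up ℤ).Rel 0 1 from zero_add 1) h01
  have hd : D.d 0 1 = e₀.hom ≫ f ≫ e₁.inv := HomologicalComplex.double_d _ _ h01
  let φ : D ⟶ (HomologicalComplex.single C (ComplexShape.up ℤ) 1).obj K :=
    HomologicalComplex.mkHomToSingle (e₁.hom ≫ p) (by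
      intro k hk
      obtain rfl : k = 0 := by simpa using hk
      rw [hd]
      simp [w])
  refine ⟨φ, ⟨fun n => ?_⟩⟩
  by_cases hn : n = 1
  · subst hn
    -- Dually, in degree 1 the condition is that `A → B → K` is exact with `B → K` epi; in degree 0
    -- it is that `f` is mono.
    rw [quasiIsoAt_iff' φ 0 1 2 (by simp) (by simp),
      ShortComplex.quasiIso_iff_of_zeros']
    · have hφ : φ.f 1 = (e₁.hom ≫ p) ≫
        (HomologicalComplex.singleObjXSelf (ComplexShape.up ℤ) 1 K).inv :=
        HomologicalComplex.mkHomToSingle_f _ _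
      constructor
      · refine ShortComplex.exact_of_iso ?_ hex
        refine ShortComplex.isoMk e₀.symm e₁.symm
          (HomologicalComplex.singleObjXSelf (ComplexShape.up ℤ) 1 K).symm ?_ ?_
        · change _ ≫ D.d 0 1 = _
          rw [hd]
          simp
          rfl
        · change _ ≫ φ.f 1 = _
          rw [hφ]
          simp
          rfl
      · change Epi (φ.f 1)
        rw [hφ]
        infer_instance
    · exact HomologicalComplex.double_d_eq_zero₀ f
            (show (ComplexShape.up ℤ).Rel 0 1 from zero_add 1) _ _ (by norm_num)
    · exact HomologicalComplex.single_obj_d (ComplexShape.up ℤ) 1 K _ _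
    · exact HomologicalComplex.single_obj_d (ComplexShape.up ℤ) 1 K _ _
  · rw [quasiIsoAt_iff_exactAt']
    · by_cases hn1 : n = 0
      · subst hn1
        rw [HomologicalComplex.exactAt_iff' _ (-1) 0 1 (by simp) (by simp),
          ShortComplex.exact_iff_mono]
        · change Mono (D.d 0 1)
          rw [hd]
          infer_instance
        · exact HomologicalComplex.double_d_eq_zero₀ f
            (show (ComplexShape.up ℤ).Rel 0 1 from zero_add 1) _ _ (by norm_num)
      · exact exactAt_double f n hn1 hn
    · rw [HomologicalComplex.exactAt_iff]
      exact ShortComplex.exact_of_isZero_X₂ _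
        (HomologicalComplex.isZero_single_obj_X (ComplexShape.up ℤ) 1 K n hn)

variable [HasDerivedCategory.{w} C]

theorem nonempty_iso_double_of_kernel {K A B : C} (i : K ⟶ A) (f : A ⟶ B) (w : i ≫ f = 0)
    [Mono i] [Epi f] (hex : (ShortComplex.mk i f w).Exact) :
    Nonempty ((DerivedCategory.singleFunctor C 0).obj K ≅ DerivedCategory.Q.obj
      (HomologicalComplex.double f (show (ComplexShape.up ℤ).Rel 0 1 from zero_add 1))) := by
  obtain ⟨φ, hφ⟩ := quasiIso_to_double i f w hex
  have := (DerivedCategory.isIso_Q_map_iff_quasiIso C φ).2 hφ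
  exact ⟨(DerivedCategory.singleFunctorIsoCompQ C 0).app K ≪≫
    @asIso _ _ _ _ (DerivedCategory.Q.map φ) this⟩

/-- The cokernel sits in degree 1, and the shift by 1 brings it to degree 0. This is what makes
`𝒪(-2)[1]` correspond to an honest representation. -/
theorem nonempty_iso_double_shift_of_cokernel {K A B : C} (f : A ⟶ B) (p : B ⟶ K)
    (w : f ≫ p = 0) [Mono f] [Epi p] (hex : (ShortComplex.mk f p w).Exact) :
    Nonempty ((DerivedCategory.singleFunctor C 0).obj K ≅ (DerivedCategory.Q.obj
      (HomologicalComplex.double f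
        (show (ComplexShape.up ℤ).Rel 0 1 from zero_add 1)))⟦(1 : ℤ)⟧) := by
  obtain ⟨φ, hφ⟩ := quasiIso_from_double f p w hex
  have := (DerivedCategory.isIso_Q_map_iff_quasiIso C φ).2 hφ
  let e := @asIso _ _ _ _ (DerivedCategory.Q.map φ) this ≪≫
    ((DerivedCategory.singleFunctorIsoCompQ C 1).app K).symm
  exact ⟨(((DerivedCategory.singleFunctors C).shiftIso 1 0 1 (add_zero 1)).app K).symm ≪≫
    (shiftFunctor (DerivedCategory C) (1 : ℤ)).mapIso e.symm⟩

end Homological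

/-! ## Representations as objects of the abelian category -/

namespace QuiverRep

/-- An isomorphism of representations. -/
structure Equiv (V W : QuiverRep) where
  e₀ : V.V₀ ≃ₗ[ℂ] W.V₀
  e₁ : V.V₁ ≃ₗ[ℂ] W.V₁
  comm_a : ∀ i v, e₁ (V.a i v) = W.a i (e₀ v)
  comm_b : ∀ i v, e₀ (V.b i v) = W.b i (e₁ v)
  comm_c : ∀ v, e₀ (V.c v) = W.c (e₀ v)
  comm_d : ∀ v, e₁ (V.d v) = W.d (e₁ v)

/-- The morphism underlying an isomorphism of representations. -/
def Equiv.toHom {V W : QuiverRep} (e : Equiv V W) : Hom V W where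
  f₀ := e.e₀
  f₁ := e.e₁
  comm_a := e.comm_a
  comm_b := e.comm_b
  comm_c := e.comm_c
  comm_d := e.comm_d

theorem Hom.mono_toRepCat {V W : QuiverRep} (f : Hom V W) (h₀ : Function.Injective f.f₀)
    (h₁ : Function.Injective f.f₁) : Mono f.toRepCat := by
  have : ∀ x, Mono (f.toRepCat.app x) := by
    rintro ⟨x⟩
    cases x with
    | v0 => exact (ModuleCat.mono_iff_injective _).2 h₀
    | v1 => exact (ModuleCat.mono_iff_injective _).2 h₁
  exact NatTrans.mono_of_mono_app _

theorem Hom.epi_toRepCat {V W : QuiverRep} (f : Hom V W) (h₀ : Function.Surjective f.f₀)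
    (h₁ : Function.Surjective f.f₁) : Epi f.toRepCat := by
  have : ∀ x, Epi (f.toRepCat.app x) := by
    rintro ⟨x⟩
    cases x with
    | v0 => exact (ModuleCat.epi_iff_surjective _).2 h₀
    | v1 => exact (ModuleCat.epi_iff_surjective _).2 h₁
  exact NatTrans.epi_of_epi_app _

theorem Hom.toRepCat_comp_eq_zero {U V W : QuiverRep} (f : Hom U V) (g : Hom V W)
    (h₀ : ∀ v, g.f₀ (f.f₀ v) = 0) (h₁ : ∀ v, g.f₁ (f.f₁ v) = 0) :
    f.toRepCat ≫ g.toRepCat = 0 := by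
  ext x : 2
  obtain ⟨x⟩ := x
  cases x with
  | v0 => exact ModuleCat.hom_ext (LinearMap.ext h₀)
  | v1 => exact ModuleCat.hom_ext (LinearMap.ext h₁)

theorem Hom.exact_toRepCat {U V W : QuiverRep} (f : Hom U V) (g : Hom V W)
    (h₀ : Function.Exact f.f₀ g.f₀) (h₁ : Function.Exact f.f₁ g.f₁) :
    (ShortComplex.mk f.toRepCat g.toRepCat (f.toRepCat_comp_eq_zero g h₀.apply_apply_eq_zero
      h₁.apply_apply_eq_zero)).Exact := by
  apply exact_of_evaluation
  rintro ⟨x⟩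
  rw [ShortComplex.ShortExact.moduleCat_exact_iff_function_exact]
  cases x with
  | v0 => exact h₀
  | v1 => exact h₁

theorem Equiv.nonempty_iso {V W : QuiverRep} (e : Equiv V W) :
    Nonempty (V.toRepCat ≅ W.toRepCat) := by
  have := e.toHom.mono_toRepCat e.e₀.injective e.e₁.injective
  have := e.toHom.epi_toRepCat e.e₀.surjective e.e₁.surjective
  have := isIso_of_mono_of_epi e.toHom.toRepCat
  exact ⟨asIso e.toHom.toRepCat⟩

theorem toRepCat_naturality {V W : QuiverRep} (φ : V.toRepCat ⟶ W.toRepCat) {x y : Vertex}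
    (e : Arrow x y) : V.mapArrow e ≫ φ.app ⟨y⟩ = φ.app ⟨x⟩ ≫ W.mapArrow e := by
  have h := φ.naturality ((CategoryTheory.Quotient.functor Rel).map (arr e))
  change V.pathFunctor.map (arr e) ≫ _ = _ ≫ W.pathFunctor.map (arr e) at h
  rw [pathFunctor_map_arr, pathFunctor_map_arr] at h
  exact h

theorem nonempty_equiv_of_iso {V W : QuiverRep} (φ : V.toRepCat ≅ W.toRepCat) :
    Nonempty (Equiv V W) :=
  ⟨{ e₀ := (φ.app ⟨Vertex.v0⟩).toLinearEquiv
     e₁ := (φ.app ⟨Vertex.v1⟩).toLinearEquiv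
     comm_a := fun i v => congrArg (fun f => f.hom v) (toRepCat_naturality φ.hom (.a i))
     comm_b := fun i v => congrArg (fun f => f.hom v) (toRepCat_naturality φ.hom (.b i))
     comm_c := fun v => congrArg (fun f => f.hom v) (toRepCat_naturality φ.hom .c)
     comm_d := fun v => congrArg (fun f => f.hom v) (toRepCat_naturality φ.hom .d) }⟩

/-- The functor placing a representation in degree 0 is fully faithful, so one explicit model `W` of
`E` turns every question about `E` into linear algebra. -/
theorem isIsoTo_iff_nonempty_equiv {W : QuiverRep} {E : DerivedCategory RepCat}
    (hW : W.IsIsoTo E) (V : QuiverRep) : V.IsIsoTo E ↔ Nonempty (Equiv V W) := by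
  obtain ⟨e⟩ := hW
  constructor
  · rintro ⟨f⟩
    exact nonempty_equiv_of_iso
      ((DerivedCategory.singleFunctor RepCat 0).preimageIso (f ≪≫ e.symm))
  · rintro ⟨f⟩
    obtain ⟨g⟩ := f.nonempty_iso
    exact ⟨(DerivedCategory.singleFunctor RepCat 0).mapIso g ≪≫ e⟩

end QuiverRep

/-! ### Complexes `RHom(𝒪 ⊕ L, F)` concentrated in one degree. -/

namespace Tilting

variable {X : TwoChart} (P : Tilting X) (F : QCoh X)

/-- `RHom(𝒪 ⊕ L, F)` is the kernel of the Čech differential if this is surjective. -/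
theorem isIsoTo_rHom {K : QuiverRep} (i : QuiverRep.Hom K (P.cech₀ F))
    (inj₀ : Function.Injective i.f₀) (inj₁ : Function.Injective i.f₁)
    (ex₀ : Function.Exact i.f₀ (cechD F 1)) (ex₁ : Function.Exact i.f₁ (cechD F P.u))
    (surj₀ : Function.Surjective (cechD F 1)) (surj₁ : Function.Surjective (cechD F P.u)) :
    K.IsIsoTo (P.rHom F) := by
  have := i.mono_toRepCat inj₀ inj₁
  have := (P.cechHom F).epi_toRepCat surj₀ surj₁
  exact nonempty_iso_double_of_kernel _ _ _ (i.exact_toRepCat (P.cechHom F) ex₀ ex₁)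

/-- `RHom(𝒪 ⊕ L, F)[1]` is the cokernel of the Čech differential if this is injective. -/
theorem isIsoTo_rHom_shift {K : QuiverRep} (p : QuiverRep.Hom (P.cech₁ F) K)
    (inj₀ : Function.Injective (cechD F 1)) (inj₁ : Function.Injective (cechD F P.u))
    (ex₀ : Function.Exact (cechD F 1) p.f₀) (ex₁ : Function.Exact (cechD F P.u) p.f₁)
    (surj₀ : Function.Surjective p.f₀) (surj₁ : Function.Surjective p.f₁) :
    K.IsIsoTo ((P.rHom F)⟦(1 : ℤ)⟧) := by
  have := (P.cechHom F).mono_toRepCat inj₀ inj₁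
  have := p.epi_toRepCat surj₀ surj₁
  exact nonempty_iso_double_shift_of_cokernel _ _ _ ((P.cechHom F).exact_toRepCat p ex₀ ex₁)

end Tilting

/-! ## The Čech complex of `𝒪(k)` on the projective line -/

section Cech

open Polynomial LaurentPolynomial

/-- The Čech differential of `𝒪(k)` on the projective line. -/
def lineD (k : ℤ) : (ℂ[X] × ℂ[X]) →ₗ[ℂ] ℂ[T;T⁻¹] :=
  LinearMap.mulLeft ℂ (T k) ∘ₗ (invert (R := ℂ)).toLinearMap ∘ₗ
      Polynomial.toLaurentAlg.toLinearMap ∘ₗ LinearMap.snd ℂ ℂ[X] ℂ[X] -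
    Polynomial.toLaurentAlg.toLinearMap ∘ₗ LinearMap.fst ℂ ℂ[X] ℂ[X]

theorem lineD_apply (k : ℤ) (m : ℂ[X] × ℂ[X]) :
    lineD k m = T k * invert (toLaurent m.2) - toLaurent m.1 := rfl

theorem toLaurent_coeff_natCast (f : ℂ[X]) (n : ℕ) :
    (toLaurent f).coeff (n : ℤ) = f.coeff n := by
  induction f using Polynomial.induction_on' with
  | add p q hp hq =>
    rw [map_add, AddMonoidAlgebra.coeff_add, Finsupp.add_apply, hp, hq, Polynomial.coeff_add]
  | monomial i r =>
    rw [← Polynomial.C_mul_X_pow_eq_monomial, Polynomial.toLaurent_C_mul_X_pow,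
      ← single_eq_C_mul_T, Polynomial.coeff_C_mul_X_pow, AddMonoidAlgebra.coeff_single,
      Finsupp.single_apply]
    simp [eq_comm]

theorem toLaurent_coeff_of_neg (f : ℂ[X]) {n : ℤ} (hn : n < 0) :
    (toLaurent f).coeff n = 0 := by
  induction f using Polynomial.induction_on' with
  | add p q hp hq =>
    rw [map_add, AddMonoidAlgebra.coeff_add, Finsupp.add_apply, hp, hq, add_zero]
  | monomial i r =>
    rw [← Polynomial.C_mul_X_pow_eq_monomial, Polynomial.toLaurent_C_mul_X_pow,
      ← single_eq_C_mul_T, AddMonoidAlgebra.coeff_single, Finsupp.single_apply, if_neg]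
    omega

theorem T_mul_coeff (k n : ℤ) (f : ℂ[T;T⁻¹]) : (T k * f).coeff n = f.coeff (n - k) := by
  induction f using LaurentPolynomial.induction_on' with
  | add p q hp hq =>
    rw [mul_add, AddMonoidAlgebra.coeff_add, AddMonoidAlgebra.coeff_add, Finsupp.add_apply,
      Finsupp.add_apply, hp, hq]
  | C_mul_T i r =>
    rw [T_mul, mul_T_assoc, ← single_eq_C_mul_T, ← single_eq_C_mul_T,
      AddMonoidAlgebra.coeff_single, AddMonoidAlgebra.coeff_single, Finsupp.single_apply,
      Finsupp.single_apply]
    congr 1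
    apply propext
    constructor <;> intro h <;> omega

/-- The chart `U₀` contributes only to degrees `n ≥ 0` and `U₁` only to `n ≤ k`. Hence the kernel
lives in `0 ≤ n ≤ k` and the cokernel in `k < n < 0`. -/
theorem lineD_coeff (k n : ℤ) (m : ℂ[X] × ℂ[X]) :
    (lineD k m).coeff n = (toLaurent m.2).coeff (k - n) - (toLaurent m.1).coeff n := by
  rw [lineD_apply, AddMonoidAlgebra.coeff_sub, Finsupp.sub_apply, T_mul_coeff, invert_apply,
    neg_sub]

theorem lineD_eq_zero_iff (k : ℤ) (m : ℂ[X] × ℂ[X]) :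
    lineD k m = 0 ↔ ∀ n, (toLaurent m.2).coeff (k - n) = (toLaurent m.1).coeff n := by
  constructor
  · intro h n
    rw [← sub_eq_zero, ← lineD_coeff, h]
    rfl
  · intro h
    ext n
    rw [lineD_coeff, h, sub_self]
    rfl

/-- The image of the Čech differential contains the monomials which extend to a chart. -/
theorem C_mul_T_mem_range_lineD (k n : ℤ) (r : ℂ) (h : 0 ≤ n ∨ n ≤ k) :
    LaurentPolynomial.C r * T n ∈ LinearMap.range (lineD k) := by
  rcases h with h | h
  · lift n to ℕ using h
    refine ⟨(-(Polynomial.C r * X ^ n), 0), ?_⟩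
    rw [lineD_apply]
    simp [-map_mul]
  · obtain ⟨j, rfl⟩ : ∃ j : ℕ, n = k - j := ⟨(k - n).toNat, by omega⟩
    refine ⟨(0, Polynomial.C r * X ^ j), ?_⟩
    rw [lineD_apply, Polynomial.toLaurent_C_mul_X_pow, map_mul, invert_C, invert_T, T_mul,
      mul_T_assoc, map_zero, sub_zero, add_comm, ← sub_eq_add_neg]

theorem mem_range_lineD (k : ℤ) (p : ℂ[T;T⁻¹])
    (h : ∀ n, k < n → n < 0 → p.coeff n = 0) : p ∈ LinearMap.range (lineD k) := by
  rw [← AddMonoidAlgebra.sum_coeff_single p]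
  refine Submodule.sum_mem _ fun n _ => ?_
  rw [single_eq_C_mul_T]
  by_cases hn : 0 ≤ n ∨ n ≤ k
  · exact C_mul_T_mem_range_lineD k n _ hn
  · rw [h n (by omega) (by omega)]
    simp

/-- The gap `k < n < 0` contains no integer. -/
theorem lineD_surjective {k : ℤ} (hk : -1 ≤ k) : Function.Surjective (lineD k) :=
  fun p => mem_range_lineD k p fun n _ _ => by omega

/-- For `k < 0` the ranges `n ≥ 0` and `n ≤ k` are disjoint, so no cancellation between the charts
is possible. -/
theorem lineD_injective {k : ℤ} (hk : k < 0) : Function.Injective (lineD k) := by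
  rw [← LinearMap.ker_eq_bot, LinearMap.ker_eq_bot']
  intro m hm
  rw [lineD_eq_zero_iff] at hm
  ext n
  · rw [← toLaurent_coeff_natCast, ← hm, toLaurent_coeff_of_neg _ (by omega)]
    rfl
  · have := hm (k - n)
    rw [sub_sub_cancel, toLaurent_coeff_natCast, toLaurent_coeff_of_neg _ (by omega)] at this
    exact this

/-- The image of the Čech differential is cut out by the coefficients of `Tⁿ` for
`k < n < 0`. -/
theorem mem_range_lineD_iff {k : ℤ} (p : ℂ[T;T⁻¹]) :
    p ∈ LinearMap.range (lineD k) ↔ ∀ n, k < n → n < 0 → p.coeff n = 0 := by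
  refine ⟨?_, mem_range_lineD k p⟩
  rintro ⟨m, rfl⟩ n h₁ h₂
  rw [lineD_coeff, toLaurent_coeff_of_neg _ h₂, toLaurent_coeff_of_neg _ (by omega), sub_zero]

theorem lineD_zero_eq_zero_iff (m : ℂ[X] × ℂ[X]) :
    lineD 0 m = 0 ↔ ∃ r : ℂ, m = (Polynomial.C r, Polynomial.C r) := by
  rw [lineD_eq_zero_iff]
  constructor
  · intro h
    refine ⟨m.1.coeff 0, Prod.ext ?_ ?_⟩
    · ext n
      cases n with
      | zero => simp
      | succ n =>
        rw [← toLaurent_coeff_natCast, ← h, toLaurent_coeff_of_neg _ (by omega),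
          Polynomial.coeff_C_succ]
    · ext n
      have := h (-n)
      rw [zero_sub, neg_neg, toLaurent_coeff_natCast] at this
      rw [this]
      cases n with
      | zero =>
        rw [Nat.cast_zero, neg_zero, ← Nat.cast_zero, toLaurent_coeff_natCast,
          Polynomial.coeff_C_zero]
      | succ n => rw [toLaurent_coeff_of_neg _ (by omega), Polynomial.coeff_C_succ]
  · rintro ⟨r, rfl⟩ n
    simp only [Polynomial.toLaurent_C, C_apply]
    congr 1
    simp

/-- The sections of `𝒪(1)` are the linear forms: `r + s z = z (r w + s)` with `w = z⁻¹`. -/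
theorem lineD_one_eq_zero_iff (m : ℂ[X] × ℂ[X]) :
    lineD 1 m = 0 ↔ ∃ r s : ℂ, m = (Polynomial.C r + Polynomial.C s * X,
      Polynomial.C r * X + Polynomial.C s) := by
  constructor
  · intro h
    rw [lineD_eq_zero_iff] at h
    have h₀ : m.2.coeff 1 = m.1.coeff 0 := by
      simpa [← toLaurent_coeff_natCast] using h 0
    have h₁ : m.2.coeff 0 = m.1.coeff 1 := by
      simpa [← toLaurent_coeff_natCast] using h 1
    refine ⟨m.1.coeff 0, m.1.coeff 1, Prod.ext ?_ ?_⟩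
    · ext n
      match n with
      | 0 => simp
      | 1 => simp [Polynomial.coeff_C_succ]
      | n + 2 =>
        rw [← toLaurent_coeff_natCast, ← h, toLaurent_coeff_of_neg _ (by push_cast; omega)]
        simp
    · ext n
      match n with
      | 0 => simp [h₁]
      | 1 => simp [h₀, Polynomial.coeff_C_succ]
      | n + 2 =>
        have := h (1 - (n + 2 : ℕ))
        rw [sub_sub_cancel, toLaurent_coeff_natCast, toLaurent_coeff_of_neg _ (by push_cast; omega)]
          at this
        rw [this]
        simp
  · rintro ⟨r, s, rfl⟩
    rw [lineD_apply]
    simp only [map_add, map_mul, Polynomial.toLaurent_C, Polynomial.toLaurent_X, invert_C, invert_T,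
      mul_add, T_mul, mul_T_assoc]
    simp

end Cech

/-! ## The images of `𝒪(n)` on the exceptional curves -/

/-- The one-dimensional representation at the vertex `0`, on which `c` acts by `a`. -/
def vertexRep (a : ℂ) : QuiverRep where
  V₀ := ℂ
  V₁ := PUnit
  a _ := 0
  b _ := 0
  c := a • LinearMap.id
  d := 0
  aba _ _ := rfl
  bab _ _ := rfl
  da _ _ := rfl
  cb _ _ := by simp

/-- The representation `ℂ → ℂ²` given by the two coordinate inclusions `a₁`, `a₂`. -/
def inclRep (a : ℂ) : QuiverRep where
  V₀ := ℂ
  V₁ := Fin 2 → ℂ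
  a i := LinearMap.single ℂ (fun _ => ℂ) i
  b _ := 0
  c := a • LinearMap.id
  d := a • LinearMap.id
  aba _ _ := by simp
  bab _ _ := by simp
  da _ _ := by simp [← Pi.single_smul]
  cb _ _ := by simp

/-- The representation `ℂ² → ℂ` given by the two coordinate projections `b₁`, `b₂`. -/
def projRep (a : ℂ) : QuiverRep where
  V₀ := ℂ
  V₁ := Fin 2 → ℂ
  a _ := 0
  b i := LinearMap.proj i
  c := a • LinearMap.id
  d := a • LinearMap.id
  aba _ _ := by simp
  bab _ _ := by simp
  da _ _ := by simp
  cb _ _ := by simp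

/-! ### The coordinates of `X₀` acting on `j_{a*} 𝒪(n)`. -/

section

open Polynomial LaurentPolynomial Tilting

theorem evalZero_XC (a : ℂ) (f : ℂ[T;T⁻¹]) : evalZero ℂ[T;T⁻¹] a (XC f) = f :=
  evalZero_C _ a f

theorem evalZero_X (B : Type) [CommRing B] [Algebra ℂ B] (a : ℂ) (i : Fin 3) :
    evalZero B a (MvPolynomial.X i) = ![0, 0, algebraMap ℂ B a] i :=
  MvPolynomial.aevalTower_X _ _ _

theorem evalZero_X_castSucc (B : Type) [CommRing B] [Algebra ℂ B] (a : ℂ) (i : Fin 2) :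
    evalZero B a (MvPolynomial.X i.castSucc) = 0 := by
  rw [evalZero_X]
  fin_cases i <;> rfl

/-- On the curve, homomorphisms from `𝒪(m)` to `𝒪(n)` form `𝒪(n - m)`. -/
theorem cechD_jO (a : ℂ) (n m : ℤ) (x : ℂ[X] × ℂ[X]) :
    cechD (jO a n) (X0.zPow m) x = lineD (n - m) x := by
  change evalZero ℂ[T;T⁻¹] a (XC (T (-m))) * (T n * invert (toLaurent x.2)) - toLaurent x.1 = _
  rw [evalZero_XC, lineD_apply, ← mul_assoc, ← T_add, neg_add_eq_sub]

theorem X0.zPow_zero : X0.zPow 0 = 1 := by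
  ext1
  exact XC_T_zero

theorem cechD_jO_one (a : ℂ) (n : ℤ) (x : ℂ[X] × ℂ[X]) :
    cechD (jO a n) 1 x = lineD n x := by
  rw [← X0.zPow_zero, cechD_jO, sub_zero]

theorem mulPair_jO (a : ℂ) (n : ℤ) {u : X0.A₀₁ˣ} (s : GlobalSection X0 u) (x : ℂ[X] × ℂ[X]) :
    mulPair (jO a n) s x = (evalZero ℂ[X] a s.g₀ * x.1, evalZero ℂ[X] a s.g₁ * x.2) := rfl

theorem mulOverlap_jO (a : ℂ) (n : ℤ) {u : X0.A₀₁ˣ} (s : GlobalSection X0 u) (p : ℂ[T;T⁻¹]) :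
    mulOverlap (jO a n) s p = toLaurent (evalZero ℂ[X] a s.g₀) * p :=
  congrArg (· * p) (DFunLike.congr_fun (j_comm₀ a) s.g₀)

/-- The fibre coordinates vanish on the zero section, so the arrows they represent act by zero. -/
theorem mulPair_jO_fibreCoord (a : ℂ) (n : ℤ) (i : Fin 2) (x : ℂ[X] × ℂ[X]) :
    mulPair (jO a n) (fibreCoord i) x = (0 : ℂ[X] × ℂ[X]) := by
  rw [mulPair_jO]
  simp only [fibreCoord, evalZero_X_castSucc, zero_mul]
  rfl

theorem mulPair_jO_tCoord (a : ℂ) (n : ℤ) (x : ℂ[X] × ℂ[X]) :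
    mulPair (jO a n) tCoord x = (a • x : ℂ[X] × ℂ[X]) := by
  rw [mulPair_jO]
  simp only [tCoord, evalZero_X]
  exact Prod.ext (Algebra.smul_def a x.1).symm (Algebra.smul_def a x.2).symm

theorem mulPair_jO_homogCoord_zero (a : ℂ) (n : ℤ) (x : ℂ[X] × ℂ[X]) :
    mulPair (jO a n) (homogCoord 0) x = ((x.1, X * x.2) : ℂ[X] × ℂ[X]) := by
  rw [mulPair_jO]
  simp only [homogCoord, evalZero_C, one_mul]
  rfl

theorem mulPair_jO_homogCoord_one (a : ℂ) (n : ℤ) (x : ℂ[X] × ℂ[X]) :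
    mulPair (jO a n) (homogCoord 1) x = ((X * x.1, x.2) : ℂ[X] × ℂ[X]) := by
  rw [mulPair_jO]
  simp only [homogCoord, evalZero_C, one_mul]
  rfl

theorem mulOverlap_jO_fibreCoord (a : ℂ) (n : ℤ) (i : Fin 2) (p : ℂ[T;T⁻¹]) :
    mulOverlap (jO a n) (fibreCoord i) p = (0 : ℂ[T;T⁻¹]) := by
  rw [mulOverlap_jO]
  simp only [fibreCoord, evalZero_X_castSucc, map_zero, zero_mul]
  rfl

theorem mulOverlap_jO_tCoord (a : ℂ) (n : ℤ) (p : ℂ[T;T⁻¹]) :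
    mulOverlap (jO a n) tCoord p = (a • p : ℂ[T;T⁻¹]) := by
  rw [mulOverlap_jO]
  simp only [tCoord, evalZero_X]
  change toLaurent (algebraMap ℂ ℂ[X] a) * p = _
  rw [Polynomial.algebraMap_apply, Algebra.algebraMap_self_apply, Polynomial.toLaurent_C,
    LaurentPolynomial.smul_eq_C_mul]

theorem mulOverlap_jO_homogCoord_zero (a : ℂ) (n : ℤ) (p : ℂ[T;T⁻¹]) :
    mulOverlap (jO a n) (homogCoord 0) p = p := by
  rw [mulOverlap_jO]
  simp only [homogCoord, map_one, one_mul]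
  rfl

theorem mulOverlap_jO_homogCoord_one (a : ℂ) (n : ℤ) (p : ℂ[T;T⁻¹]) :
    mulOverlap (jO a n) (homogCoord 1) p = (T 1 * p : ℂ[T;T⁻¹]) := by
  rw [mulOverlap_jO]
  simp only [homogCoord, evalZero_C, Polynomial.toLaurent_X]
  rfl

/-! ### Explicit bases of `H⁰(𝒪)`, `H⁰(𝒪(1))`, `H¹(𝒪(-2))` and `H¹(𝒪(-3))`. -/

/-- The constant functions on the projective line. -/
def constPair : ℂ →ₗ[ℂ] ℂ[X] × ℂ[X] :=
  (Algebra.linearMap ℂ ℂ[X]).prod (Algebra.linearMap ℂ ℂ[X])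

theorem constPair_injective : Function.Injective constPair := fun _ _ h =>
  Polynomial.C_injective (congrArg Prod.fst h)

theorem exact_constPair : Function.Exact constPair (lineD 0) := fun m => by
  rw [lineD_zero_eq_zero_iff]
  exact exists_congr fun r => eq_comm

/-- The linear forms on the projective line, as sections of `𝒪(1)`. -/
def linearForm : (Fin 2 → ℂ) →ₗ[ℂ] ℂ[X] × ℂ[X] where
  toFun v := (Polynomial.C (v 0) + Polynomial.C (v 1) * X,
    Polynomial.C (v 0) * X + Polynomial.C (v 1))
  map_add' v w := by
    ext1 <;> simp only [Pi.add_apply, map_add, Prod.mk_add_mk] <;> ring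
  map_smul' r v := by
    ext1 <;> simp [Polynomial.smul_eq_C_mul, mul_assoc]

theorem linearForm_apply (v : Fin 2 → ℂ) : linearForm v =
    (Polynomial.C (v 0) + Polynomial.C (v 1) * X,
      Polynomial.C (v 0) * X + Polynomial.C (v 1)) := rfl

theorem linearForm_single_zero (r : ℂ) :
    linearForm (Pi.single 0 r) = (Polynomial.C r, X * Polynomial.C r) := by
  simp [linearForm_apply, mul_comm X]

theorem linearForm_single_one (r : ℂ) :
    linearForm (Pi.single 1 r) = (X * Polynomial.C r, Polynomial.C r) := by
  simp [linearForm_apply, mul_comm X]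

theorem linearForm_injective : Function.Injective linearForm := fun v w h => by
  have h₀ := congrArg (fun p => p.1.coeff 0) h
  have h₁ := congrArg (fun p => p.2.coeff 0) h
  simp [linearForm_apply] at h₀ h₁
  ext i
  fin_cases i <;> assumption

theorem exact_linearForm : Function.Exact linearForm (lineD 1) := fun m => by
  rw [lineD_one_eq_zero_iff]
  constructor
  · rintro ⟨r, s, rfl⟩
    exact ⟨![r, s], rfl⟩
  · rintro ⟨v, rfl⟩
    exact ⟨v 0, v 1, rfl⟩

/-- The coefficient of `Tⁿ`. -/
def laurentCoeff (n : ℤ) : ℂ[T;T⁻¹] →ₗ[ℂ] ℂ where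
  toFun p := p.coeff n
  map_add' _ _ := rfl
  map_smul' _ _ := rfl

theorem exact_laurentCoeff : Function.Exact (lineD (-2)) (laurentCoeff (-1)) := fun p => by
  rw [← LinearMap.coe_range, SetLike.mem_coe, mem_range_lineD_iff]
  constructor
  · intro h n h₁ h₂
    obtain rfl : n = -1 := by omega
    exact h
  · intro h
    exact h (-1) (by norm_num) (by norm_num)

/-- The coefficients of `T⁻¹` and `T⁻²`. -/
def laurentCoeffPair : ℂ[T;T⁻¹] →ₗ[ℂ] (Fin 2 → ℂ) :=
  LinearMap.pi ![laurentCoeff (-1), laurentCoeff (-2)]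

theorem exact_laurentCoeffPair : Function.Exact (lineD (-3)) laurentCoeffPair := fun p => by
  rw [← LinearMap.coe_range, SetLike.mem_coe, mem_range_lineD_iff]
  constructor
  · intro h n h₁ h₂
    obtain rfl | rfl : n = -1 ∨ n = -2 := by omega
    · exact congrFun h 0
    · exact congrFun h 1
  · intro h
    ext i
    fin_cases i
    · exact h (-1) (by norm_num) (by norm_num)
    · exact h (-2) (by norm_num) (by norm_num)

theorem laurentCoeff_single (n m : ℤ) (r : ℂ) :
    laurentCoeff n (AddMonoidAlgebra.single m r) = if m = n then r else 0 :=
  Finsupp.single_apply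

theorem laurentCoeff_surjective (n : ℤ) : Function.Surjective (laurentCoeff n) := fun r =>
  ⟨AddMonoidAlgebra.single n r, Finsupp.single_eq_same⟩

theorem laurentCoeffPair_surjective : Function.Surjective laurentCoeffPair := fun v => by
  refine ⟨AddMonoidAlgebra.single (-1) (v 0) + AddMonoidAlgebra.single (-2) (v 1), ?_⟩
  ext i
  fin_cases i
  · change laurentCoeff (-1) (_ + _) = v 0
    rw [map_add, laurentCoeff_single, laurentCoeff_single]
    norm_num
  · change laurentCoeff (-2) (_ + _) = v 1
    rw [map_add, laurentCoeff_single, laurentCoeff_single]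
    norm_num

/-- The vertex `0` sees `𝒪`, with only constants as cohomology; the vertex `1` sees `𝒪(-1)`, which
has none. -/
theorem vertexRep_isIsoTo (a : ℂ) : (vertexRep a).IsIsoTo (Phi (jO a 0)) := by
  have e₀ : ⇑(cechD (jO a 0) 1) = lineD 0 := funext fun x => cechD_jO_one a 0 x
  have e₁ : ⇑(cechD (jO a 0) tilting.u) = lineD (-1) := funext fun x => cechD_jO a 0 1 x
  let i : QuiverRep.Hom (vertexRep a) (tilting.cech₀ (jO a 0)) :=
    { f₀ := constPair
      f₁ := (0 : PUnit →ₗ[ℂ] ℂ[X] × ℂ[X])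
      comm_a := fun i v => (mulPair_jO_fibreCoord a 0 i (constPair v)).symm
      comm_b := fun i v => by
        refine (map_zero constPair).trans ?_
        exact (map_zero (mulPair (jO a 0) (homogCoord i))).symm
      comm_c := fun v => by
        refine Eq.trans ?_ (mulPair_jO_tCoord a 0 (constPair v)).symm
        exact map_smul constPair a v
      comm_d := fun v => (map_zero (mulPair (jO a 0) tCoord)).symm }
  refine tilting.isIsoTo_rHom (jO a 0) i constPair_injective
    (Function.injective_of_subsingleton (α := PUnit) _) ?_ ?_ ?_ ?_
  · rw [e₀]
    exact exact_constPair
  · rw [e₁]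
    intro m
    refine (map_eq_zero_iff _ (lineD_injective (by norm_num))).trans ?_
    exact ⟨fun h => ⟨PUnit.unit, h.symm⟩, fun ⟨_, h⟩ => h.symm⟩
  · rw [e₀]
    exact lineD_surjective (by norm_num)
  · rw [e₁]
    exact lineD_surjective (by norm_num)

/-- On the flop `L = 𝒪(-1)`, so the vertex `1` sees `𝒪(1)`, and the `aᵢ` multiply a constant by the
two homogeneous coordinates. -/
theorem inclRep_isIsoTo (a : ℂ) : (inclRep a).IsIsoTo (PhiPlus (jO a 0)) := by
  have e₀ : ⇑(cechD (jO a 0) 1) = lineD 0 := funext fun x => cechD_jO_one a 0 x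
  have e₁ : ⇑(cechD (jO a 0) tiltingPlus.u) = lineD 1 := funext fun x => cechD_jO a 0 (-1) x
  let i : QuiverRep.Hom (inclRep a) (tiltingPlus.cech₀ (jO a 0)) :=
    { f₀ := constPair
      f₁ := linearForm
      comm_a := fun i (v : ℂ) => by
        change linearForm (Pi.single i v) = mulPair (jO a 0) (homogCoord i) (constPair v)
        fin_cases i
        · exact (linearForm_single_zero v).trans (mulPair_jO_homogCoord_zero a 0 (constPair v)).symm
        · exact (linearForm_single_one v).trans (mulPair_jO_homogCoord_one a 0 (constPair v)).symm
      comm_b := fun i (v : Fin 2 → ℂ) => by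
        refine (map_zero constPair).trans ?_
        exact (mulPair_jO_fibreCoord a 0 i (linearForm v)).symm
      comm_c := fun (v : ℂ) => by
        refine Eq.trans ?_ (mulPair_jO_tCoord a 0 (constPair v)).symm
        exact map_smul constPair a v
      comm_d := fun (v : Fin 2 → ℂ) => by
        refine Eq.trans ?_ (mulPair_jO_tCoord a 0 (linearForm v)).symm
        exact map_smul linearForm a v }
  refine tiltingPlus.isIsoTo_rHom (jO a 0) i constPair_injective linearForm_injective ?_ ?_ ?_ ?_
  · rw [e₀]
    exact exact_constPair
  · rw [e₁]
    exact exact_linearForm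
  · rw [e₀]
    exact lineD_surjective (by norm_num)
  · rw [e₁]
    exact lineD_surjective (by norm_num)

/-- Here the vertices see `𝒪(-2)` and `𝒪(-3)`, which have only `H¹`, of dimensions 1 and 2; hence
the cokernel and the shift. -/
theorem projRep_isIsoTo (a : ℂ) : (projRep a).IsIsoTo ((Phi (jO a (-2)))⟦(1 : ℤ)⟧) := by
  have e₀ : ⇑(cechD (jO a (-2)) 1) = lineD (-2) := funext fun x => cechD_jO_one a (-2) x
  have e₁ : ⇑(cechD (jO a (-2)) tilting.u) = lineD (-3) := funext fun x => cechD_jO a (-2) 1 x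
  let p : QuiverRep.Hom (tilting.cech₁ (jO a (-2))) (projRep a) :=
    { f₀ := laurentCoeff (-1)
      f₁ := laurentCoeffPair
      comm_a := fun i v => by
        refine (congrArg laurentCoeffPair (mulOverlap_jO_fibreCoord a (-2) i v)).trans ?_
        exact map_zero laurentCoeffPair
      comm_b := fun i v => by
        change laurentCoeff (-1) (mulOverlap (jO a (-2)) (homogCoord i) v) =
          laurentCoeffPair v i
        fin_cases i
        · exact congrArg (laurentCoeff (-1)) (mulOverlap_jO_homogCoord_zero a (-2) v)
        · refine (congrArg (laurentCoeff (-1)) (mulOverlap_jO_homogCoord_one a (-2) v)).trans ?_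
          -- Multiplication by `z` moves the coefficient of `T⁻²` to `T⁻¹`; this is why
          -- `laurentCoeffPair` lists `T⁻¹` before `T⁻²`.
          exact T_mul_coeff 1 (-1) v
      comm_c := fun v => by
        refine (congrArg (laurentCoeff (-1)) (mulOverlap_jO_tCoord a (-2) v)).trans ?_
        exact map_smul (laurentCoeff (-1)) a _
      comm_d := fun v => by
        refine (congrArg laurentCoeffPair (mulOverlap_jO_tCoord a (-2) v)).trans ?_
        exact map_smul laurentCoeffPair a _ }
  refine tilting.isIsoTo_rHom_shift (jO a (-2)) p ?_ ?_ ?_ ?_ (laurentCoeff_surjective (-1))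
    laurentCoeffPair_surjective
  · rw [e₀]
    exact lineD_injective (by norm_num)
  · rw [e₁]
    exact lineD_injective (by norm_num)
  · rw [e₀]
    exact exact_laurentCoeff
  · rw [e₁]
    exact exact_laurentCoeffPair

end

/-! ## Stability and the classification of stable framed representations -/

namespace QuiverRep

/-- The inverse of an isomorphism of representations. -/
def Equiv.symm {V W : QuiverRep} (e : Equiv V W) : Equiv W V where
  e₀ := e.e₀.symm
  e₁ := e.e₁.symm
  comm_a i v := by rw [LinearEquiv.symm_apply_eq, e.comm_a, e.e₀.apply_symm_apply]
  comm_b i v := by rw [LinearEquiv.symm_apply_eq, e.comm_b, e.e₁.apply_symm_apply]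
  comm_c v := by rw [LinearEquiv.symm_apply_eq, e.comm_c, e.e₀.apply_symm_apply]
  comm_d v := by rw [LinearEquiv.symm_apply_eq, e.comm_d, e.e₁.apply_symm_apply]

/-- The arrows `aᵢ` generate the vector space at the vertex `1`. -/
def Generated (V : QuiverRep) : Prop :=
  ∀ W : Submodule ℂ V.V₁, (∀ i v, V.a i v ∈ W) → W = ⊤

/-- The arrows `bᵢ` cogenerate the vector space at the vertex `1`. -/
def Cogenerated (V : QuiverRep) : Prop :=
  ∀ v, (∀ i, V.b i v = 0) → v = 0

theorem Equiv.generated {V : QuiverRep} {a : ℂ} (e : Equiv V (inclRep a)) : V.Generated := by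
  intro W hW
  rw [eq_top_iff]
  rintro x -
  let f₀ : V.V₀ ≃ₗ[ℂ] ℂ := e.e₀
  let f₁ : V.V₁ ≃ₗ[ℂ] (Fin 2 → ℂ) := e.e₁
  have hf : ∀ i v, f₁ (V.a i v) = Pi.single i (f₀ v) := e.comm_a
  have key : ∀ i z, f₁.symm (Pi.single i z) ∈ W := fun i z => by
    have := hW i (f₀.symm z)
    rwa [← f₁.symm_apply_apply (V.a i _), hf, f₀.apply_symm_apply] at this
  rw [← f₁.symm_apply_apply x, ← Finset.univ_sum_single (f₁ x), map_sum]
  exact W.sum_mem fun i _ => key i _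

theorem Equiv.cogenerated {V : QuiverRep} {a : ℂ} (e : Equiv V (projRep a)) :
    V.Cogenerated := by
  intro v hv
  rw [← e.e₁.map_eq_zero_iff]
  funext i
  have h := e.comm_b i v
  rw [hv i, map_zero] at h
  exact h.symm

end QuiverRep

namespace FramedRep

variable {V : FramedRep}

/-- An isomorphism of the framing with the vertex `0`. -/
def framingEquiv (hι : Function.Bijective V.ι) : ℂ ≃ₗ[ℂ] V.V₀ :=
  LinearEquiv.ofBijective V.ι hι

theorem finrank_V₀ (hι : Function.Bijective V.ι) : Module.finrank ℂ V.V₀ = 1 := by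
  rw [← (framingEquiv hι).finrank_eq, Module.finrank_self]

theorem eq_bot_or_eq_top (hι : Function.Bijective V.ι) (W : Submodule ℂ V.V₀) :
    W = ⊥ ∨ W = ⊤ := by
  have := isSimpleModule_iff_finrank_eq_one.2 (finrank_V₀ hι)
  exact IsSimpleOrder.eq_bot_or_eq_top W

theorem ι_apply (V : FramedRep) (z : ℂ) : V.ι z = z • V.ι 1 := by
  rw [← map_smul, smul_eq_mul, mul_one]

/-- An endomorphism of a line is a scalar. This scalar is the parameter `a` locating the curve. -/
theorem exists_c_eq_smul (hι : Function.Bijective V.ι) : ∃ a : ℂ, ∀ v, V.c v = a • v := by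
  obtain ⟨a, ha⟩ := hι.2 (V.c (V.ι 1))
  refine ⟨a, fun v => ?_⟩
  obtain ⟨z, rfl⟩ := hι.2 v
  rw [V.ι_apply z, map_smul, ← ha, V.ι_apply a, smul_comm]

/-! ### Stability in terms of generation and cogeneration. -/

theorem IsStable.theta_neg {Θ : ℝ × ℝ} (h : V.IsStable Θ) (hι : Function.Bijective V.ι) :
    Θ.1 + Θ.2 * Module.finrank ℂ V.V₁ < 0 := by
  have h₀ := finrank_V₀ hι
  have hne : (⊤ : Submodule ℂ V.V₀) ≠ ⊥ := by
    intro e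
    have := congrArg (fun W : Submodule ℂ V.V₀ => Module.finrank ℂ W) e
    simp [h₀] at this
  have := h.sub_zero ⊤ ⊤ ⟨fun _ _ _ => trivial, fun _ _ _ => trivial, fun _ _ => trivial,
    fun _ _ => trivial⟩ fun e => hne e.1
  rwa [Theta, finrank_top, finrank_top, h₀, Nat.cast_one, mul_one] at this

/-- The common kernel of the `bᵢ` is `d`-stable because `c bᵢ = bᵢ d`. With `W₀ = 0` it is a
subrepresentation on which `Θ ≥ 0`, so it must vanish. -/
theorem IsStable.cogenerated {Θ : ℝ × ℝ} (h : V.IsStable Θ) (hΘ : 0 < Θ.2) :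
    V.Cogenerated := by
  intro v hv
  let W : Submodule ℂ V.V₁ := ⨅ i, LinearMap.ker (V.b i)
  have hW : ∀ w, w ∈ W ↔ ∀ i, V.b i w = 0 := fun w => by simp [W]
  have hsub : V.IsSubrep ⊥ W := by
    refine ⟨fun i v hv => ?_, fun i v hv => ?_, fun v hv => ?_, fun v hv => ?_⟩
    · rw [(Submodule.mem_bot ℂ).1 hv, map_zero]
      exact W.zero_mem
    · exact (Submodule.mem_bot ℂ).2 ((hW v).1 hv i)
    · rw [(Submodule.mem_bot ℂ).1 hv, map_zero]
      exact Submodule.zero_mem _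
    · rw [hW] at hv ⊢
      intro i
      rw [← V.cb, hv, map_zero]
  by_contra hne
  have hbot : W ≠ ⊥ := fun e => hne ((Submodule.mem_bot ℂ).1 (e ▸ (hW v).2 hv))
  have := h.sub_zero ⊥ W hsub fun e => hbot e.2
  rw [Theta, finrank_bot, Nat.cast_zero, mul_zero, zero_add] at this
  exact absurd this (not_lt.2 (by positivity))

/-- The sum of the images of the `aᵢ` is `d`-stable because `d aᵢ = aᵢ c`. Together with `V₀` it
contains the framing, and if it were proper, `θ₁ < 0` would give it a larger `Θ` than `V`. -/
theorem IsStable.generated [Module.Finite ℂ V.V₁] {Θ : ℝ × ℝ} (h : V.IsStable Θ)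
    (hΘ : Θ.2 < 0) : V.Generated := by
  let W : Submodule ℂ V.V₁ := ⨆ i, LinearMap.range (V.a i)
  have hW : ∀ i v, V.a i v ∈ W := fun i v => Submodule.mem_iSup_of_mem i ⟨v, rfl⟩
  have hsub : V.IsSubrep ⊤ W := by
    refine ⟨fun i v _ => hW i v, fun _ _ _ => trivial, fun _ _ => trivial, fun v hv => ?_⟩
    have : W ≤ W.comap V.d := iSup_le fun i => by
      rintro _ ⟨v, rfl⟩
      rw [Submodule.mem_comap, V.da]
      exact hW _ _
    exact this hv
  have htop : W = ⊤ := by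
    by_contra hne
    have := h.sub_framed ⊤ W hsub (fun _ => trivial) fun e => hne e.2
    rw [Theta, Theta, finrank_top, add_lt_add_iff_left, mul_lt_mul_left_of_neg hΘ] at this
    exact absurd (Submodule.finrank_le W) (not_le.2 (by exact_mod_cast this))
  intro W' hW'
  rw [eq_top_iff, ← htop]
  exact iSup_le fun i => by
    rintro _ ⟨v, rfl⟩
    exact hW' i v

/-- For the converse, cogeneration excludes `W₀ = 0`. If `W₀ = V₀`, shrinking `W₁` only lowers `Θ`,
which settles both the unframed and the framed clauses. -/
theorem isStable_iff_cogenerated [Module.Finite ℂ V.V₁] (hι : Function.Bijective V.ι)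
    {Θ : ℝ × ℝ} (hΘ : 0 < Θ.2) :
    V.IsStable Θ ↔ V.Cogenerated ∧ Θ.1 + Θ.2 * Module.finrank ℂ V.V₁ < 0 := by
  refine ⟨fun h => ⟨h.cogenerated hΘ, h.theta_neg hι⟩, fun ⟨hco, hneg⟩ => ⟨?_, ?_⟩⟩
  · intro W₀ W₁ hsub hne
    rcases eq_bot_or_eq_top hι W₀ with rfl | rfl
    · refine absurd ⟨rfl, ?_⟩ hne
      rw [eq_bot_iff]
      exact fun v hv => (Submodule.mem_bot ℂ).2
        (hco v fun i => (Submodule.mem_bot ℂ).1 (hsub.b i v hv))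
    · rw [Theta, finrank_top, finrank_V₀ hι, Nat.cast_one, mul_one]
      refine lt_of_le_of_lt ?_ hneg
      gcongr
      exact Submodule.finrank_le W₁
  · intro W₀ W₁ hsub hmem hne
    obtain rfl : W₀ = ⊤ := by
      rw [eq_top_iff]
      rintro v -
      obtain ⟨z, rfl⟩ := hι.2 v
      exact hmem z
    rw [Theta, Theta, finrank_top]
    gcongr
    exact Submodule.finrank_lt fun e => hne ⟨rfl, e⟩

/-- For the converse, `W₀ = 0` gives `Θ = θ₁ dim W₁ < 0` at once, while `W₀ = V₀` forces `W₁ = V₁`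
by generation, so no proper framed subrepresentation exists. -/
theorem isStable_iff_generated [Module.Finite ℂ V.V₁] (hι : Function.Bijective V.ι)
    {Θ : ℝ × ℝ} (hΘ : Θ.2 < 0) :
    V.IsStable Θ ↔ V.Generated ∧ Θ.1 + Θ.2 * Module.finrank ℂ V.V₁ < 0 := by
  refine ⟨fun h => ⟨h.generated hΘ, h.theta_neg hι⟩, fun ⟨hgen, hneg⟩ => ⟨?_, ?_⟩⟩
  · intro W₀ W₁ hsub hne
    rcases eq_bot_or_eq_top hι W₀ with rfl | rfl
    · have hbot : W₁ ≠ ⊥ := fun e => hne ⟨rfl, e⟩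
      rw [Theta, finrank_bot, Nat.cast_zero, mul_zero, zero_add]
      refine mul_neg_of_neg_of_pos hΘ (Nat.cast_pos.2 (Nat.pos_of_ne_zero fun e => hbot ?_))
      exact Submodule.finrank_eq_zero.1 e
    · obtain rfl := hgen W₁ fun i v => hsub.a i v trivial
      rwa [Theta, finrank_top, finrank_top, finrank_V₀ hι, Nat.cast_one, mul_one]
  · intro W₀ W₁ hsub hmem hne
    obtain rfl : W₀ = ⊤ := by
      rw [eq_top_iff]
      rintro v -
      obtain ⟨z, rfl⟩ := hι.2 v
      exact hmem z
    exact absurd ⟨rfl, hgen W₁ fun i v => hsub.a i v trivial⟩ hne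

/-! ### Classification of generated and cogenerated representations. -/

/-- The map `ℂ² → V₁` given by the images of the framing vector under `a₁`, `a₂`. -/
def genMap (V : FramedRep) : (Fin 2 → ℂ) →ₗ[ℂ] V.V₁ :=
  Fintype.linearCombination ℂ fun i => V.a i (V.ι 1)

theorem genMap_apply (V : FramedRep) (x : Fin 2 → ℂ) :
    V.genMap x = x 0 • V.a 0 (V.ι 1) + x 1 • V.a 1 (V.ι 1) := by
  rw [genMap, Fintype.linearCombination_apply, Fin.sum_univ_two]

theorem genMap_single (V : FramedRep) (i : Fin 2) (z : ℂ) :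
    V.genMap (Pi.single i z) = V.a i (V.ι z) := by
  rw [genMap, Fintype.linearCombination_apply_single, V.ι_apply z, map_smul]

theorem genMap_surjective (hι : Function.Bijective V.ι) (h : V.Generated) :
    Function.Surjective V.genMap := by
  rw [← LinearMap.range_eq_top]
  refine h _ fun i v => ?_
  obtain ⟨z, rfl⟩ := hι.2 v
  exact ⟨_, V.genMap_single i z⟩

theorem finrank_le_of_generated (hι : Function.Bijective V.ι) (h : V.Generated) :
    Module.finrank ℂ V.V₁ ≤ 2 := by
  have := LinearMap.finrank_le_finrank_of_surjective (genMap_surjective hι h)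
  rwa [Module.finrank_fin_fun] at this

/-- The map `V₁ → ℂ²` given by `b₁`, `b₂`. -/
def cogenMap (hι : Function.Bijective V.ι) : V.V₁ →ₗ[ℂ] (Fin 2 → ℂ) :=
  LinearMap.pi fun i => (framingEquiv hι).symm.toLinearMap ∘ₗ V.b i

theorem cogenMap_apply (hι : Function.Bijective V.ι) (v : V.V₁) (i : Fin 2) :
    cogenMap hι v i = (framingEquiv hι).symm (V.b i v) := rfl

theorem ι_cogenMap (hι : Function.Bijective V.ι) (v : V.V₁) (i : Fin 2) :
    V.ι (cogenMap hι v i) = V.b i v :=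
  (framingEquiv hι).apply_symm_apply (V.b i v)

theorem cogenMap_injective (hι : Function.Bijective V.ι) (h : V.Cogenerated) :
    Function.Injective (cogenMap hι) := by
  rw [← LinearMap.ker_eq_bot, LinearMap.ker_eq_bot']
  intro v hv
  exact h v fun i => by rw [← ι_cogenMap hι, hv, Pi.zero_apply, map_zero]

theorem finrank_le_of_cogenerated (hι : Function.Bijective V.ι) (h : V.Cogenerated) :
    Module.finrank ℂ V.V₁ ≤ 2 := by
  have := LinearMap.finrank_le_finrank_of_injective (cogenMap_injective hι h)
  rwa [Module.finrank_fin_fun] at this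

theorem exists_equiv_vertexRep_iff [Module.Finite ℂ V.V₁] (hι : Function.Bijective V.ι) :
    (∃ a, Nonempty (V.toQuiverRep.Equiv (vertexRep a))) ↔ Module.finrank ℂ V.V₁ = 0 := by
  constructor
  · rintro ⟨a, ⟨e⟩⟩
    rw [e.e₁.finrank_eq]
    exact Module.finrank_zero_of_subsingleton (M := PUnit)
  · intro h
    have := Module.finrank_zero_iff.1 h
    obtain ⟨a, ha⟩ := exists_c_eq_smul hι
    let e₁ : V.V₁ ≃ₗ[ℂ] PUnit := LinearEquiv.ofFinrankEq _ _
      (h.trans (Module.finrank_zero_of_subsingleton (M := PUnit)).symm)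
    exact ⟨a, ⟨{
      e₀ := (framingEquiv hι).symm
      e₁ := e₁
      comm_a := fun i v => rfl
      comm_b := fun i v => by
        rw [Subsingleton.elim v 0, map_zero]
        exact map_zero (framingEquiv hι).symm
      comm_c := fun v => by
        rw [ha]
        exact map_smul (framingEquiv hι).symm a v
      comm_d := fun v => rfl }⟩⟩

/-- Let `e` be the framing vector, `bᵢ a₁ e = r e` and `bᵢ a₂ e = s e`. The relation `a₂ bᵢ a₁ = a₁
bᵢ a₂` reads `r a₂ e = s a₁ e`, and independence of `a₁ e`, `a₂ e` gives `r = s = 0`. -/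
theorem b_a_eq_zero_of_injective (hι : Function.Bijective V.ι)
    (h : Function.Injective V.genMap) (i j : Fin 2) (v : V.V₀) : V.b i (V.a j v) = 0 := by
  obtain ⟨r, hr⟩ := hι.2 (V.b i (V.a 0 (V.ι 1)))
  obtain ⟨s, hs⟩ := hι.2 (V.b i (V.a 1 (V.ι 1)))
  have hrs : V.genMap (Pi.single 1 r) = V.genMap (Pi.single 0 s) := by
    rw [genMap_single, genMap_single, hr, hs, V.aba]
  have h₁ : r = 0 := by simpa using congrFun (h hrs) 1
  have h₀ : s = 0 := by simpa using (congrFun (h hrs) 0).symm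
  obtain ⟨z, rfl⟩ := hι.2 v
  rw [V.ι_apply z, map_smul, map_smul]
  fin_cases j
  · change z • V.b i (V.a 0 (V.ι 1)) = 0
    rw [← hr, h₁, map_zero, smul_zero]
  · change z • V.b i (V.a 1 (V.ι 1)) = 0
    rw [← hs, h₀, map_zero, smul_zero]

/-- In dimension 2 the surjection `genMap` is bijective, so `b` vanishes on all of `V₁`; `d aᵢ = aᵢ
c` makes `d` the same scalar as `c`. -/
theorem exists_equiv_inclRep_iff [Module.Finite ℂ V.V₁] (hι : Function.Bijective V.ι) :
    (∃ a, Nonempty (V.toQuiverRep.Equiv (inclRep a))) ↔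
      V.Generated ∧ Module.finrank ℂ V.V₁ = 2 := by
  constructor
  · rintro ⟨a, ⟨e⟩⟩
    refine ⟨e.generated, ?_⟩
    rw [e.e₁.finrank_eq]
    exact Module.finrank_fin_fun ℂ
  · rintro ⟨hgen, hdim⟩
    have hsurj := genMap_surjective hι hgen
    have hinj : Function.Injective V.genMap :=
      (LinearMap.injective_iff_surjective_of_finrank_eq_finrank
        ((Module.finrank_fin_fun ℂ).trans hdim.symm)).2 hsurj
    obtain ⟨a, ha⟩ := exists_c_eq_smul hι
    let e : QuiverRep.Equiv (inclRep a) V.toQuiverRep :=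
      { e₀ := framingEquiv hι
        e₁ := LinearEquiv.ofBijective V.genMap ⟨hinj, hsurj⟩
        comm_a := fun i z => V.genMap_single i z
        comm_b := fun i (x : Fin 2 → ℂ) => by
          refine (map_zero (framingEquiv hι)).trans (Eq.symm ?_)
          change V.b i (V.genMap x) = 0
          rw [genMap_apply, map_add, map_smul, map_smul, b_a_eq_zero_of_injective hι hinj,
            b_a_eq_zero_of_injective hι hinj, smul_zero, smul_zero, add_zero]
        comm_c := fun (z : ℂ) => (map_smul V.ι a z).trans (ha _).symm
        comm_d := fun (x : Fin 2 → ℂ) => by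
          change V.genMap (a • x) = V.d (V.genMap x)
          rw [map_smul, genMap_apply, map_add, map_smul, map_smul, V.da, V.da, ha, map_smul,
            map_smul, smul_add, smul_comm a, smul_comm a] }
    exact ⟨a, ⟨e.symm⟩⟩

theorem a_eq_zero_of_surjective (hι : Function.Bijective V.ι) (hco : V.Cogenerated)
    (h : Function.Surjective (cogenMap hι)) (i : Fin 2) (v : V.V₀) : V.a i v = 0 := by
  have key : V.a i (V.ι 1) = 0 := by
    -- `u` and `w` form the basis of `V₁` dual to `b₁`, `b₂`. Applied to them, `b₂ aᵢ b₁ = b₁ aᵢ b₂`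
    -- shows that `aᵢ` of the framing vector is killed by `b₂` and by `b₁`.
    obtain ⟨u, hu⟩ := h (Pi.single 0 1)
    obtain ⟨w, hw⟩ := h (Pi.single 1 1)
    have hu' := V.bab i u
    have hw' := V.bab i w
    rw [← ι_cogenMap hι u, ← ι_cogenMap hι u, hu] at hu'
    rw [← ι_cogenMap hι w, ← ι_cogenMap hι w, hw] at hw'
    refine hco _ fun k => ?_
    fin_cases k
    · simpa using hw'.symm
    · simpa using hu'
  obtain ⟨z, rfl⟩ := hι.2 v
  rw [V.ι_apply z, map_smul, key, smul_zero]

theorem exists_equiv_projRep_iff [Module.Finite ℂ V.V₁] (hι : Function.Bijective V.ι) :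
    (∃ a, Nonempty (V.toQuiverRep.Equiv (projRep a))) ↔
      V.Cogenerated ∧ Module.finrank ℂ V.V₁ = 2 := by
  constructor
  · rintro ⟨a, ⟨e⟩⟩
    refine ⟨e.cogenerated, ?_⟩
    rw [e.e₁.finrank_eq]
    exact Module.finrank_fin_fun ℂ
  · rintro ⟨hco, hdim⟩
    have hinj := cogenMap_injective hι hco
    have hsurj : Function.Surjective (cogenMap hι) :=
      (LinearMap.injective_iff_surjective_of_finrank_eq_finrank
        (hdim.trans (Module.finrank_fin_fun ℂ).symm)).1 hinj
    obtain ⟨a, ha⟩ := exists_c_eq_smul hι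
    exact ⟨a, ⟨{
      e₀ := (framingEquiv hι).symm
      e₁ := LinearEquiv.ofBijective (cogenMap hι) ⟨hinj, hsurj⟩
      comm_a := fun i v => by
        rw [a_eq_zero_of_surjective hι hco hsurj]
        exact map_zero (cogenMap hι)
      comm_b := fun i v => rfl
      comm_c := fun v => by
        rw [ha]
        exact map_smul (framingEquiv hι).symm a v
      comm_d := fun v => by
        funext i
        change cogenMap hι (V.d v) i = a * cogenMap hι v i
        rw [cogenMap_apply, ← V.cb, ha, map_smul]
        rfl }⟩⟩

end FramedRep

end Conifold

end

/-! ### The five chambers. -/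

theorem proposition2p9 (V : Conifold.FramedRep) [Module.Finite ℂ V.V₀] [Module.Finite ℂ V.V₁]
    (hι : Function.Bijective V.ι) (hV₁ : Module.finrank ℂ V.V₁ ≠ 1) (Θ : ℝ × ℝ) :
    (Θ ∈ Conifold.chamberI → (V.IsStable Θ ↔
      ∃ a : ℂ, V.IsIsoTo (Conifold.Phi (Conifold.jO a 0)))) ∧
    (Θ ∈ Conifold.chamberII → (V.IsStable Θ ↔
      ∃ a : ℂ, V.IsIsoTo (Conifold.Phi (Conifold.jO a 0)) ∨
        V.IsIsoTo ((Conifold.Phi (Conifold.jO a (-2)))⟦(1 : ℤ)⟧))) ∧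
    (Θ ∈ Conifold.chamberIII → (V.IsStable Θ ↔
      ∃ a : ℂ, V.IsIsoTo (Conifold.Phi (Conifold.jO a 0)) ∨
        V.IsIsoTo (Conifold.PhiPlus (Conifold.jO a 0)))) ∧
    (Θ ∈ Conifold.chamberIV → (V.IsStable Θ ↔
      ∃ a : ℂ, V.IsIsoTo (Conifold.PhiPlus (Conifold.jO a 0)))) ∧
    (Θ ∈ Conifold.chamberV → ¬ V.IsStable Θ) := by
  -- This replaces every geometric alternative by a condition on `dim V₁` and on generation or
  -- cogeneration.
  simp only [Conifold.QuiverRep.isIsoTo_iff_nonempty_equiv (Conifold.vertexRep_isIsoTo _),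
    Conifold.QuiverRep.isIsoTo_iff_nonempty_equiv (Conifold.inclRep_isIsoTo _),
    Conifold.QuiverRep.isIsoTo_iff_nonempty_equiv (Conifold.projRep_isIsoTo _), exists_or,
    Conifold.FramedRep.exists_equiv_vertexRep_iff hι,
    Conifold.FramedRep.exists_equiv_inclRep_iff hι,
    Conifold.FramedRep.exists_equiv_projRep_iff hι]
  have hco : V.Cogenerated → Module.finrank ℂ V.V₁ = 0 ∨ Module.finrank ℂ V.V₁ = 2 :=
    fun h => by have := Conifold.FramedRep.finrank_le_of_cogenerated hι h; omega
  have hgen : V.Generated → Module.finrank ℂ V.V₁ = 0 ∨ Module.finrank ℂ V.V₁ = 2 :=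
    fun h => by have := Conifold.FramedRep.finrank_le_of_generated hι h; omega
  have hco₀ : Module.finrank ℂ V.V₁ = 0 → V.Cogenerated := fun h v _ =>
    have := Module.finrank_zero_iff.1 h
    Subsingleton.elim v 0
  have hgen₀ : Module.finrank ℂ V.V₁ = 0 → V.Generated := fun h W _ =>
    have := Module.finrank_zero_iff.1 h
    Subsingleton.elim W ⊤
  refine ⟨?_, ?_, ?_, ?_, ?_⟩
  · rintro ⟨h₁, h₂⟩
    -- `θ₀ < 0 < θ₀ + 2θ₁` forces `θ₁ > 0`, and dimension 2 is excluded by `Θ(V) = θ₀ + 2θ₁ > 0`.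
    rw [Conifold.FramedRep.isStable_iff_cogenerated hι (by linarith)]
    constructor
    · rintro ⟨h, hneg⟩
      refine (hco h).resolve_right fun e => ?_
      rw [e] at hneg
      push_cast at hneg
      linarith
    · intro e
      exact ⟨hco₀ e, by rw [e]; simpa using h₁⟩
  · rintro ⟨h₁, h₂⟩
    -- Here `θ₀` and `θ₀ + 2θ₁` are both negative, so both dimensions survive.
    rw [Conifold.FramedRep.isStable_iff_cogenerated hι h₁]
    constructor
    · rintro ⟨h, -⟩
      exact (hco h).imp_right fun e => ⟨h, e⟩
    · rintro (e | ⟨h, e⟩)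
      · exact ⟨hco₀ e, by rw [e]; push_cast; linarith⟩
      · exact ⟨h, by rw [e]; push_cast; linarith⟩
  · rintro ⟨h₁, h₂⟩
    rw [Conifold.FramedRep.isStable_iff_generated hι h₂]
    constructor
    · rintro ⟨h, -⟩
      exact (hgen h).imp_right fun e => ⟨h, e⟩
    · rintro (e | ⟨h, e⟩)
      · exact ⟨hgen₀ e, by rw [e]; push_cast; linarith⟩
      · exact ⟨h, by rw [e]; push_cast; linarith⟩
  · rintro ⟨h₁, h₂⟩
    -- `θ₀ > 0 > θ₀ + 2θ₁` forces `θ₁ < 0`, and dimension 0 is excluded by `Θ(V) = θ₀ > 0`.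
    rw [Conifold.FramedRep.isStable_iff_generated hι (by linarith)]
    constructor
    · rintro ⟨h, hneg⟩
      refine ⟨h, (hgen h).resolve_left fun e => ?_⟩
      rw [e] at hneg
      push_cast at hneg
      linarith
    · rintro ⟨h, e⟩
      exact ⟨h, by rw [e]; push_cast; linarith⟩
  · rintro ⟨h₁, h₂⟩
    rw [Conifold.FramedRep.isStable_iff_generated hι h₁]
    rintro ⟨h, hneg⟩
    -- Both possible values of `Θ(V)`, namely `θ₀` and `θ₀ + 2θ₁`, are positive in this chamber.
    rcases hgen h with e | e <;> rw [e] at hneg <;> push_cast at hneg <;> linarith
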